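/- Fix a period $L>0$, an incidence angle $\theta\in\mathbb R$, a shift spacing $h>0$, a number of shifts $j\in\mathbb N$, $j\ge 1$, and a coupling constant $\gamma\ge 0$. Let $D_0\subset\mathbb R^2$ be a compact set with boundary of class $C^2$ (near each boundary point $D_0$ is a sublevel set $\{\varphi\le 0\}$ of a $C^2$ function with non-vanishing gradient), with outward unit normal $\nu$ and arc length $dS$ on $\partial D_0$. Assume that the translates $D_n=D_0+nL(1,0)$, $n\in\mathbb Z$, are mutually disjoint and that $h>|y-y'|$ for all $(x,y),(x',y')\in\partial D_0$. For $k>0$ and $n\in\mathbb Z$ put $\alpha=k\sin\theta$, $\alpha_n(k)=\alpha+\frac{2\pi}{L}n$; let $\beta_n(k)$ be the square root of $k^2-\alpha_n(k)^2$ that is non-negative or has positive imaginary part; and let $\sigma_n(k)=(1-e^{i\beta_n(k)h})^j-1$. A Wood frequency is a $k_0>0$ with $k_0^2=\alpha_n(k_0)^2$ for some $n\in\mathbb Z$; put $\mathcal N_{\mathrm{wa}}=\{n\in\mathbb Z:\beta_n(k_0)=0\}$. Let $$G_{j,k}(X,Y)=\frac i4\sum_{\ell=0}^{j}(-1)^\ell\binom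 j\ell H_0^{(1)}\!\left(k\sqrt{X^2+(Y+\ell h)^2}\right),\qquad G^q_{j,k}(X,Y)=\sum_{n\in\mathbb Z}e^{-i\alpha nL}G_{j,k}(X+nL,Y),$$ $$I^+_{n,k}[\psi]=\int_{\partial D_0}\left(\frac{\partial}{\partial\nu(r')}-i\gamma\right)\!\left(e^{-i\alpha_n(k)x'-i\beta_n(k)y'}\right)\psi(r')\,dS(r'),$$ where $H_0^{(1)}$ is the Hankel function of the first kind of order zero and $r'=(x',y')$. For a Wood frequency $k_0$, $k$ near $k_0$, $\psi\in C(\partial D_0)$ (the Banach space of complex-valued continuous functions on $\partial D_0$ with the maximum norm) and $r=(x,y)\in\partial D_0$ let $$A_k\psi(r)=\tfrac12\psi(r)+\int_{\partial D_0}\left(\frac{\partial}{\partial\nu(r')}-i\gamma\right)\!\left[G^q_{j,k}(r-r')\right]\psi(r')\,dS(r')-\frac{i}{2L}\sum_{n\notin\mathcal N_{\mathrm{wa}}}\sigma_n(k)\frac{I^+_{n,k}[\psi]}{\beta_n(k)}e^{i\alpha_n(k)x+i\beta_n(k)y}.$$ Let $k_0$ be a Wood frequency. Then there exists $\delta\in(0,k_0]$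 such that for every $k\in(k_0-\delta,k_0+\delta)$ the expression $A_k\psi(r)$ is well defined for all $\psi\in C(\partial D_0)$ and $r\in\partial D_0$ (that is, $\beta_n(k)\ne 0$ for $n\notin\mathcal N_{\mathrm{wa}}$; the series for $G^q_{j,k}$ converges absolutely at $r-r'$, and $G^q_{j,k}$ is differentiable there, for all distinct $r,r'\in\partial D_0$; the integrals over $\partial D_0$ exist; and the series over $n\notin\mathcal N_{\mathrm{wa}}$ converges absolutely), $A_k$ is a bounded linear operator from $C(\partial D_0)$ into $C(\partial D_0)$, and the mapping $k\mapsto A_k$ is continuous on $(k_0-\delta,k_0+\delta)$ with respect to the operator norm. -/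

import Mathlib

open MeasureTheory Set Filter Topology

noncomputable section

namespace WoodScattering

/-- The Euclidean plane; `r 0` and `r 1` are the Cartesian coordinates `x` and `y` of `r`. -/
abbrev Plane : Type := EuclideanSpace ℝ (Fin 2)

/-- The unit vector `(1, 0)`. -/
def xHat : Plane := !₂[1, 0]

/-- The unit vector `(0, 1)`. -/
def yHat : Plane := !₂[0, 1]

/-! ### Geometry of the scatterer -/

/-- The obstacle `D_n = D_0 + n L (1, 0)` of the periodic array. -/
def obstacle (D₀ : Set Plane) (L : ℝ) (n : ℤ) : Set Plane :=
  (fun r => r + ((n : ℝ) * L) • xHat) '' D₀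

/-- Near the point `p`, the set `D` is a sublevel set `{φ ≤ 0}` of a function `φ` of class `C²`
with non-zero gradient at `p`, and `v` is the normalized gradient: that is, the boundary of `D` is
of class `C²` near `p` and `v` is the unit normal at `p` that points out of `D`. -/
def IsOutwardUnitNormal (D : Set Plane) (p v : Plane) : Prop :=
  ∃ φ : Plane → ℝ, ContDiffAt ℝ 2 φ p ∧ φ p = 0 ∧ gradient φ p ≠ 0 ∧
    (∀ᶠ q in 𝓝 p, q ∈ D ↔ φ q ≤ 0) ∧ v = ‖gradient φ p‖⁻¹ • gradient φ p

/-- Along a direction `d`, the sign of `⟪v, d⟫` decides on which side of the boundary one moves. -/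
theorem IsOutwardUnitNormal.side {D : Set Plane} {p v d : Plane} (hv : IsOutwardUnitNormal D p v) :
    ‖v‖ = 1 ∧ (inner ℝ v d < 0 → ∀ᶠ t : ℝ in 𝓝[>] 0, p + t • d ∈ D) ∧
      (0 < inner ℝ v d → ∀ᶠ t : ℝ in 𝓝[>] 0, p + t • d ∉ D) := by
  obtain ⟨φ, hφ, h0, hg, hD, rfl⟩ := hv
  have hgpos : 0 < ‖gradient φ p‖ := norm_pos_iff.mpr hg
  have hder : HasDerivAt (fun t : ℝ => φ (p + t • d)) (inner ℝ (gradient φ p) d) 0 := by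
    have h1 : HasFDerivAt φ (fderiv ℝ φ p) (p + (0 : ℝ) • d) := by
      simpa using (hφ.differentiableAt (by norm_num)).hasFDerivAt
    have h2 : HasDerivAt (fun t : ℝ => p + t • d) d 0 := by
      simpa using ((hasDerivAt_id (0 : ℝ)).smul_const d).const_add p
    have h3 := h1.comp_hasDerivAt (0 : ℝ) h2
    have h4 : fderiv ℝ φ p d = inner ℝ (gradient φ p) d := by
      simp [gradient]
    rw [h4] at h3
    exact h3
  have hlim : Tendsto (fun t : ℝ => p + t • d) (𝓝[>] 0) (𝓝 p) := by
    have : Continuous fun t : ℝ => p + t • d := by fun_prop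
    simpa using (this.tendsto 0).mono_left nhdsWithin_le_nhds
  have hD' := hlim.eventually hD
  have hslope := hder.hasDerivWithinAt (s := Ioi 0)
  rw [hasDerivWithinAt_iff_tendsto_slope' (by simp)] at hslope
  refine ⟨?_, fun hneg => ?_, fun hpos => ?_⟩
  · rw [norm_smul, norm_inv, norm_norm, inv_mul_cancel₀ hgpos.ne']
  · rw [real_inner_smul_left] at hneg
    have hneg' : inner ℝ (gradient φ p) d < 0 := by
      by_contra hcon
      exact absurd hneg (not_lt.mpr (mul_nonneg (by positivity) (not_lt.mp hcon)))
    filter_upwards [hD', hslope.eventually_lt_const hneg', self_mem_nhdsWithin] with t ht hs htpos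
    rw [ht]
    simp only [slope, zero_smul, add_zero, h0, sub_zero, vsub_eq_sub, smul_eq_mul] at hs
    have htpos' : (0 : ℝ) < t := htpos
    by_contra hcon
    exact absurd hs (not_lt.mpr (mul_nonneg (by positivity) (not_le.mp hcon).le))
  · rw [real_inner_smul_left] at hpos
    have hpos' : 0 < inner ℝ (gradient φ p) d := by
      by_contra hcon
      exact absurd hpos (not_lt.mpr (mul_nonpos_of_nonneg_of_nonpos (by positivity) (not_lt.mp hcon)))
    filter_upwards [hD', hslope.eventually_const_lt hpos', self_mem_nhdsWithin] with t ht hs htpos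
    rw [ht]
    simp only [slope, zero_smul, add_zero, h0, sub_zero, vsub_eq_sub, smul_eq_mul] at hs
    have htpos' : (0 : ℝ) < t := htpos
    intro hcon
    exact absurd hs (not_lt.mpr (mul_nonpos_of_nonneg_of_nonpos (by positivity) hcon))

/-- The outward unit normal is unique: it does not depend on the defining function. -/
theorem IsOutwardUnitNormal.unique {D : Set Plane} {p v w : Plane}
    (hv : IsOutwardUnitNormal D p v) (hw : IsOutwardUnitNormal D p w) : v = w := by
  obtain ⟨nv, hvin, -⟩ := hv.side (d := w - v)
  obtain ⟨nw, -, hwout⟩ := hw.side (d := w - v)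
  by_contra hne
  have hlt : inner ℝ v w < 1 := by
    have h1 : 0 < ‖v - w‖ ^ 2 := by
      have := norm_pos_iff.mpr (sub_ne_zero.mpr hne)
      positivity
    rw [norm_sub_sq_real, nv, nw] at h1
    linarith
  have e1 := hvin (by rw [inner_sub_right, real_inner_self_eq_norm_sq, nv]; linarith)
  have e2 := hwout (by
    rw [inner_sub_right, real_inner_self_eq_norm_sq, nw, real_inner_comm]; linarith)
  obtain ⟨t, h1, h2⟩ := (e1.and e2).exists
  exact h2 h1

/-- The closed set `D` has a boundary of class `C²`. -/
def HasC2Boundary (D : Set Plane) : Prop :=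
  ∀ p ∈ frontier D, ∃ v, IsOutwardUnitNormal D p v

open Classical in
/-- The outward unit normal `ν(p)` at a boundary point `p` of a set with `C²` boundary. -/
def normal (D : Set Plane) (p : Plane) : Plane :=
  if hp : ∃ v, IsOutwardUnitNormal D p v then hp.choose else 0

/-- The boundary of a compact set is a compact space, so that `C(∂D, ℂ)` is a Banach space with the
maximum norm. -/
instance compactSpace_frontier (D : TopologicalSpace.Compacts Plane) :
    CompactSpace (frontier (D : Set Plane)) :=
  isCompact_iff_compactSpace.mp
    (D.isCompact.of_isClosed_subset isClosed_frontier D.isCompact.isClosed.frontier_subset)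

/-- Arc length on the boundary `∂D`: the one-dimensional Hausdorff measure. -/
def arcLength (D : Set Plane) : Measure (frontier D) := Measure.hausdorffMeasure 1

/-! ### Quasi-periodic modes and Wood frequencies -/

/-- `α_n(k) = k sin θ + 2 π n / L`. -/
def alpha (L θ k : ℝ) (n : ℤ) : ℝ := k * Real.sin θ + 2 * Real.pi / L * n

/-- `β_n(k)`: the square root of `k² - α_n(k)²` that is non-negative if `k² ≥ α_n(k)²` and has
positive imaginary part otherwise. -/
def beta (L θ k : ℝ) (n : ℤ) : ℂ :=
  if alpha L θ k n ^ 2 ≤ k ^ 2 then (Real.sqrt (k ^ 2 - alpha L θ k n ^ 2) : ℂ)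
  else Complex.I * (Real.sqrt (alpha L θ k n ^ 2 - k ^ 2) : ℂ)

/-- The set of Wood frequencies of an array of period `L` at incidence angle `θ`. -/
def woodFrequencies (L θ : ℝ) : Set ℝ := {k | 0 < k ∧ ∃ n : ℤ, k ^ 2 = alpha L θ k n ^ 2}

/-- The set `{n : β_n(k₀) = 0}` of the Wood modes at the frequency `k₀`. -/
def woodModes (L θ k₀ : ℝ) : Set ℤ := {n | beta L θ k₀ n = 0}

/-- `σ_n(k) = (1 - exp(i β_n(k) h)) ^ j - 1`. -/
def sigma (L θ h : ℝ) (j : ℕ) (k : ℝ) (n : ℤ) : ℂ :=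
  (1 - Complex.exp (Complex.I * beta L θ k n * h)) ^ j - 1

/-! ### Green functions -/

/-- The Hankel function `H₀⁽¹⁾(t)` of the first kind and order zero for `t > 0`, by Hankel's integral
`H₀⁽¹⁾(t) = √(2 / (π t)) e^{i (t - π / 4)} Γ(1/2)⁻¹ ∫_0^∞ e^{-u} u^{-1/2} (1 + i u / (2 t))^{-1/2} du`
(principal branch). -/
def hankelH0 (t : ℝ) : ℂ :=
  (Real.sqrt (2 / (Real.pi * t)) : ℂ) * Complex.exp (Complex.I * (t - Real.pi / 4)) *
    ((Real.Gamma (1 / 2))⁻¹ : ℝ) *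
    ∫ u in Ioi (0 : ℝ), ((Real.exp (-u) * u ^ (-(1 / 2) : ℝ) : ℝ) : ℂ) *
      (1 + Complex.I * u / (2 * t)) ^ (-(1 / 2) : ℂ)

/-- The free-space Green function `(i / 4) H₀⁽¹⁾(k |r|)` of the Helmholtz equation. -/
def freeGreen (k : ℝ) (r : Plane) : ℂ := Complex.I / 4 * hankelH0 (k * ‖r‖)

/-- The half-space Green function `G_{j,k}` with `j` shifts of spacing `h`. -/
def shiftedGreen (h : ℝ) (j : ℕ) (k : ℝ) (r : Plane) : ℂ :=
  ∑ l ∈ Finset.range (j + 1),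
    (-1 : ℂ) ^ l * (j.choose l : ℂ) * freeGreen k (r + ((l : ℝ) * h) • yHat)

/-- The term `e^{-i α n L} G_{j,k}(X + n L, Y)`, with `α = k sin θ`, of the series for `G^q_{j,k}`. -/
def quasiGreenTerm (L θ h : ℝ) (j : ℕ) (k : ℝ) (r : Plane) (n : ℤ) : ℂ :=
  Complex.exp (-Complex.I * (k * Real.sin θ * n * L : ℝ)) *
    shiftedGreen h j k (r + ((n : ℝ) * L) • xHat)

/-- The shifted quasi-periodic Green function `G^q_{j,k}`. -/
def quasiGreen (L θ h : ℝ) (j : ℕ) (k : ℝ) (r : Plane) : ℂ :=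
  ∑' n : ℤ, quasiGreenTerm L θ h j k r n

/-! ### The operator `A_k` -/

/-- The combined-field kernel of a function `G` on the plane: `∂/∂ν(r') [G (r')] - i γ G(r')`, where
`ν` is the outward unit normal of `D`. -/
def combined (D : Set Plane) (γ : ℝ) (G : Plane → ℂ) (r' : Plane) : ℂ :=
  fderiv ℝ G r' (normal D r') - Complex.I * γ * G r'

/-- The plane wave `exp(i α_n(k) x + i β_n(k) y)`. -/
def planeWave (L θ k : ℝ) (n : ℤ) (r : Plane) : ℂ :=
  Complex.exp (Complex.I * alpha L θ k n * r 0 + Complex.I * beta L θ k n * r 1)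

/-- The integrand of the integral operator in `A_k`, as a function of `r'`:
`(∂/∂ν(r') - i γ) [G^q_{j,k}(r - r')] ψ(r')`. -/
def layerIntegrand (L θ h γ : ℝ) (j : ℕ) (D : TopologicalSpace.Compacts Plane) (k : ℝ)
    (ψ : C(frontier (D : Set Plane), ℂ)) (r r' : frontier (D : Set Plane)) : ℂ :=
  combined D γ (fun s => quasiGreen L θ h j k ((r : Plane) - s)) r' * ψ r'

/-- The functional `I⁺_{n,k}[ψ]`; note that `exp(-i α_n x' - i β_n y')` is the value of the plane wave
at the point `-(x', y')`. -/
def rayleighFunctional (L θ γ : ℝ) (D : TopologicalSpace.Compacts Plane) (k : ℝ) (n : ℤ)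
    (ψ : C(frontier (D : Set Plane), ℂ)) : ℂ :=
  ∫ r', combined D γ (fun s => planeWave L θ k n (-s)) (r' : Plane) * ψ r' ∂(arcLength D)

/-- The term `σ_n(k) I⁺_{n,k}[ψ] / β_n(k) exp(i α_n(k) x + i β_n(k) y)` of the Rayleigh series. -/
def rayleighTerm (L θ h γ : ℝ) (j : ℕ) (D : TopologicalSpace.Compacts Plane) (k : ℝ)
    (ψ : C(frontier (D : Set Plane), ℂ)) (r : frontier (D : Set Plane)) (n : ℤ) : ℂ :=
  sigma L θ h j k n * (rayleighFunctional L θ γ D k n ψ / beta L θ k n) * planeWave L θ k n r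

/-- The value `(A_k ψ)(r)`, for the Wood frequency `k₀` whose Wood modes are left out of the
Rayleigh series. -/
def opA (L θ h γ : ℝ) (j : ℕ) (D : TopologicalSpace.Compacts Plane) (k₀ k : ℝ)
    (ψ : C(frontier (D : Set Plane), ℂ)) (r : frontier (D : Set Plane)) : ℂ :=
  1 / 2 * ψ r + (∫ r', layerIntegrand L θ h γ j D k ψ r r' ∂(arcLength D)) -
    Complex.I / (2 * L) * ∑' n : ↥(woodModes L θ k₀)ᶜ, rayleighTerm L θ h γ j D k ψ r n

/-- All expressions in the definition of `A_k` are meaningful: no denominator of the Rayleigh series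
vanishes, the lattice sum `G^q_{j,k}(r - r')` converges and is differentiable for distinct boundary
points, the integrals over the boundary exist, and the Rayleigh series converges. -/
structure OpAWellDefined (L θ h γ : ℝ) (j : ℕ) (D : TopologicalSpace.Compacts Plane)
    (k₀ k : ℝ) : Prop where
  denominators : ∀ n ∉ woodModes L θ k₀, beta L θ k n ≠ 0
  lattice_sum : ∀ r ∈ frontier (D : Set Plane), ∀ r' ∈ frontier (D : Set Plane), r ≠ r' →
    Summable (quasiGreenTerm L θ h j k (r - r')) ∧
      DifferentiableAt ℝ (quasiGreen L θ h j k) (r - r')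
  layer_integrable : ∀ (ψ : C(frontier (D : Set Plane), ℂ)) (r : frontier (D : Set Plane)),
    Integrable (layerIntegrand L θ h γ j D k ψ r) (arcLength D)
  functional_integrable : ∀ (ψ : C(frontier (D : Set Plane), ℂ)) (n : ℤ),
    Integrable (fun r' : frontier (D : Set Plane) =>
      combined D γ (fun s => planeWave L θ k n (-s)) (r' : Plane) * ψ r') (arcLength D)
  rayleigh_summable : ∀ (ψ : C(frontier (D : Set Plane), ℂ)) (r : frontier (D : Set Plane)),
    Summable fun n : ↥(woodModes L θ k₀)ᶜ => rayleighTerm L θ h γ j D k ψ r n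

end WoodScattering

end

/-! `A_k` is one half of the identity plus two integral operators, one from the lattice sum and one
from the Rayleigh series. Both have kernels that are jointly continuous in `(k, r, r')` off the
diagonal and are bounded by `C |r - r'|^(-1/2)`, with `C` uniform on a compact interval of
frequencies around `k₀`. Everything else follows from one abstract fact,
`WeaklySingular.exists_operator`: cutting the kernel off near the diagonal leaves a continuous
kernel, whose operator depends continuously on `k`, and the error in operator norm is `O(√ε)`
uniformly in `k`. A uniform limit of continuous maps is continuous. The measure enters only through
the bound `μ(B(x, ρ)) ≤ C ρ` (`HasC2Boundary.upperRegular_arcLength`).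

The lattice sum does not notice the Wood frequency. Since `j ≥ 1`, the binomial coefficients with
alternating signs add up to zero, so each term is a combination of differences of the Green function
at points that differ by a bounded vertical shift. At horizontal distance `X` such points have norms
that differ by `O(1/X)`, and the radial derivative is `O(X^(-1/2))`; hence the terms are
`O(|n|^(-3/2))`, as are their gradients (`exists_lattice_bound`). The sum therefore splits into
finitely many explicit kernels and a tail that is continuous and differentiable.

Among the explicit kernels only the unshifted one with `n = 0` is singular. Crude bounds from
Hankel's integral, `H₀ = O(t^(-1/2))` and `H₀' = O((1 + 1/t) t^(-1/2))`, suffice, because on a `C²`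
boundary `⟨ν(r'), r - r'⟩ = O(|r - r'|²)` (`HasC2Boundary.exists_inner_le`) and this gains one power
in the double-layer part.

In the Rayleigh series almost all modes are evanescent. If `s` is the decay rate, then `σ_n =
O(e^(-s h))`, while the two plane waves contribute at most `e^(s (y' - y))`. Compactness gives a gap
between `h` and the vertical extent of the boundary, so the series converges exponentially; near
`k₀` no remaining denominator vanishes (`eventually_beta_ne_zero`). -/

noncomputable section

namespace WoodScattering

/-! ### The Hankel function -/

/-- The integrals `∫_0^∞ e^{-u} u^p (1 + i u / (2 t))^{-q} du`. -/
def hankelIntegral (p q t : ℝ) : ℂ :=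
  ∫ u in Ioi (0 : ℝ), ((Real.exp (-u) * u ^ p : ℝ) : ℂ) * (1 + Complex.I * u / (2 * t)) ^ (-(q : ℂ))

/-- The base of the power stays on the line `Re = 1`. It therefore avoids the branch cut and has
modulus at least one, so powers with non-positive real exponent are bounded by one. -/
theorem hankelBase_re (t u : ℝ) : (1 + Complex.I * u / (2 * t) : ℂ).re = 1 := by
  have : (Complex.I * u / (2 * t) : ℂ) = ((u / (2 * t) : ℝ) : ℂ) * Complex.I := by
    push_cast; ring
  rw [this, Complex.add_re, Complex.re_ofReal_mul, Complex.one_re, Complex.I_re]; ring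

theorem hankelBase_im (t u : ℝ) : (1 + Complex.I * u / (2 * t) : ℂ).im = u / (2 * t) := by
  have : (Complex.I * u / (2 * t) : ℂ) = ((u / (2 * t) : ℝ) : ℂ) * Complex.I := by
    push_cast; ring
  rw [this, Complex.add_im, Complex.im_ofReal_mul, Complex.one_im, Complex.I_im]; ring

theorem hankelBase_mem_slitPlane (t u : ℝ) :
    (1 + Complex.I * u / (2 * t) : ℂ) ∈ Complex.slitPlane :=
  Or.inl (by rw [hankelBase_re]; exact one_pos)

theorem one_le_norm_hankelBase (t u : ℝ) : 1 ≤ ‖(1 + Complex.I * u / (2 * t) : ℂ)‖ := by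
  have := Complex.abs_re_le_norm (1 + Complex.I * u / (2 * t) : ℂ)
  rwa [hankelBase_re, abs_one] at this

theorem le_norm_hankelBase (t u : ℝ) : u / (2 * t) ≤ ‖(1 + Complex.I * u / (2 * t) : ℂ)‖ := by
  have := Complex.abs_im_le_norm (1 + Complex.I * u / (2 * t) : ℂ)
  rw [hankelBase_im] at this
  exact (le_abs_self _).trans this

theorem norm_hankelBase_cpow (q t u : ℝ) :
    ‖(1 + Complex.I * u / (2 * t) : ℂ) ^ (-(q : ℂ))‖ =
      ‖(1 + Complex.I * u / (2 * t) : ℂ)‖ ^ (-q) := by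
  rw [Complex.norm_cpow_of_ne_zero (Complex.slitPlane_ne_zero (hankelBase_mem_slitPlane t u))]
  simp

theorem norm_hankelBase_cpow_le_one {q : ℝ} (hq : 0 ≤ q) (t u : ℝ) :
    ‖(1 + Complex.I * u / (2 * t) : ℂ) ^ (-(q : ℂ))‖ ≤ 1 := by
  rw [norm_hankelBase_cpow]
  exact Real.rpow_le_one_of_one_le_of_nonpos (one_le_norm_hankelBase t u) (by linarith)

theorem integrableOn_exp_neg_mul_rpow {p : ℝ} (hp : -1 < p) :
    IntegrableOn (fun u : ℝ => Real.exp (-u) * u ^ p) (Ioi 0) := by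
  simpa using Real.GammaIntegral_convergent (s := p + 1) (by linarith)

theorem integral_exp_neg_mul_rpow {p : ℝ} (hp : -1 < p) :
    ∫ u in Ioi (0 : ℝ), Real.exp (-u) * u ^ p = Real.Gamma (p + 1) := by
  simpa using (Real.Gamma_eq_integral (s := p + 1) (by linarith)).symm

theorem measurable_hankelIntegrand (p q t : ℝ) :
    Measurable fun u : ℝ => ((Real.exp (-u) * u ^ p : ℝ) : ℂ) *
      (1 + Complex.I * u / (2 * t)) ^ (-(q : ℂ)) := by
  refine Measurable.mul (by fun_prop) ?_
  refine Continuous.measurable ?_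
  refine Continuous.cpow (by fun_prop) continuous_const fun u => hankelBase_mem_slitPlane t u

theorem norm_hankelIntegrand_le {p q t u : ℝ} (hq : 0 ≤ q) (hu : 0 < u) :
    ‖((Real.exp (-u) * u ^ p : ℝ) : ℂ) * (1 + Complex.I * u / (2 * t)) ^ (-(q : ℂ))‖ ≤
      Real.exp (-u) * u ^ p := by
  have h0 : 0 ≤ Real.exp (-u) * u ^ p := by positivity
  rw [norm_mul, Complex.norm_real, Real.norm_of_nonneg h0]
  exact mul_le_of_le_one_right h0 (norm_hankelBase_cpow_le_one hq t u)

theorem norm_hankelIntegral_le {p q : ℝ} (hp : -1 < p) (hq : 0 ≤ q) (t : ℝ) :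
    ‖hankelIntegral p q t‖ ≤ Real.Gamma (p + 1) := by
  rw [← integral_exp_neg_mul_rpow hp]
  refine norm_integral_le_of_norm_le (integrableOn_exp_neg_mul_rpow hp) ?_
  filter_upwards [self_mem_ae_restrict measurableSet_Ioi] with u hu
  exact norm_hankelIntegrand_le hq hu

/-- One factor `u` is absorbed by one power of the base, whose modulus is at least `u / (2 t)`. For
small `t` this beats the uniform bound and saves one negative power of `t` in the derivative of the
amplitude. -/
theorem norm_hankelIntegral_succ_le {p q t : ℝ} (hp : -1 < p) (hq : 0 ≤ q) (ht : 0 < t) :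
    ‖hankelIntegral (p + 1) (q + 1) t‖ ≤ 2 * t * Real.Gamma (p + 1) := by
  rw [← integral_exp_neg_mul_rpow hp, ← integral_const_mul]
  refine norm_integral_le_of_norm_le ((integrableOn_exp_neg_mul_rpow hp).const_mul _) ?_
  filter_upwards [self_mem_ae_restrict measurableSet_Ioi] with u hu
  have hu : 0 < u := hu
  have h0 : 0 ≤ Real.exp (-u) * u ^ (p + 1) := by positivity
  rw [norm_mul, Complex.norm_real, Real.norm_of_nonneg h0, norm_hankelBase_cpow,
    Real.rpow_add_one hu.ne']
  have h1 := one_le_norm_hankelBase t u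
  have h2 := le_norm_hankelBase t u
  set b := ‖(1 + Complex.I * u / (2 * t) : ℂ)‖
  have h3 : b ^ (-(q + 1)) ≤ (u / (2 * t))⁻¹ := by
    calc b ^ (-(q + 1)) ≤ b ^ (-1 : ℝ) := Real.rpow_le_rpow_of_exponent_le h1 (by linarith)
      _ = b⁻¹ := Real.rpow_neg_one b
      _ ≤ _ := by gcongr
  calc Real.exp (-u) * (u ^ p * u) * b ^ (-(q + 1))
      ≤ Real.exp (-u) * (u ^ p * u) * (u / (2 * t))⁻¹ := by gcongr
    _ = 2 * t * (Real.exp (-u) * u ^ p) := by field_simp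

/-- Differentiation under the integral stays within the family, raising `p` and `q` by one. On `s >
t / 2` the prefactor `1 / s²` is bounded, which gives the integrable majorant. -/
theorem hasDerivAt_hankelIntegral {p q t : ℝ} (hp : -1 < p) (hq : 0 ≤ q) (ht : 0 < t) :
    HasDerivAt (hankelIntegral p q)
      (Complex.I * q / (2 * t ^ 2) * hankelIntegral (p + 1) (q + 1) t) t := by
  have key := hasDerivAt_integral_of_dominated_loc_of_deriv_le
    (μ := volume.restrict (Ioi (0 : ℝ))) (𝕜 := ℝ) (x₀ := t) (s := Ioi (t / 2))
    (F := fun t u => ((Real.exp (-u) * u ^ p : ℝ) : ℂ) *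
      (1 + Complex.I * u / (2 * t)) ^ (-(q : ℂ)))
    (F' := fun t u => Complex.I * q / (2 * t ^ 2) * (((Real.exp (-u) * u ^ (p + 1) : ℝ) : ℂ) *
      (1 + Complex.I * u / (2 * t)) ^ (-((q + 1 : ℝ) : ℂ))))
    (bound := fun u => q / (2 * (t / 2) ^ 2) * (Real.exp (-u) * u ^ (p + 1)))
    (Ioi_mem_nhds (by linarith))
    (Eventually.of_forall fun s => (measurable_hankelIntegrand p q s).aestronglyMeasurable)
    ?_ ((measurable_hankelIntegrand (p + 1) (q + 1) t).const_mul _).aestronglyMeasurable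
    ?_ ((integrableOn_exp_neg_mul_rpow (by linarith)).const_mul _) ?_
  · have := key.2
    rw [integral_const_mul] at this
    exact this
  · refine (integrableOn_exp_neg_mul_rpow hp).mono'
      (measurable_hankelIntegrand p q t).aestronglyMeasurable ?_
    filter_upwards [self_mem_ae_restrict measurableSet_Ioi] with u hu
    exact norm_hankelIntegrand_le hq hu
  · filter_upwards [self_mem_ae_restrict measurableSet_Ioi] with u hu s hs
    have hs : t / 2 < s := hs
    rw [norm_mul]
    refine mul_le_mul ?_ (norm_hankelIntegrand_le (by linarith) hu) (norm_nonneg _) (by positivity)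
    rw [norm_div, norm_mul, Complex.norm_I, one_mul, Complex.norm_real, Real.norm_of_nonneg hq,
      norm_mul, norm_pow, Complex.norm_real, Real.norm_of_nonneg (by linarith), Complex.norm_two]
    gcongr
  · filter_upwards [self_mem_ae_restrict measurableSet_Ioi] with u hu s hs
    have hs : 0 < s := (half_pos ht).trans hs
    have hsC : (s : ℂ) ≠ 0 := by exact_mod_cast hs.ne'
    have hb : HasDerivAt (fun s : ℝ => (1 + Complex.I * u / (2 * s) : ℂ))
        (-(Complex.I * u / (2 * s ^ 2))) s := by
      have h1 : HasDerivAt (fun s : ℝ => (2 * s : ℂ)) 2 s := by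
        simpa using (HasDerivAt.ofReal_comp (hasDerivAt_id s)).const_mul (2 : ℂ)
      convert! ((hasDerivAt_const s (Complex.I * u : ℂ)).div h1 (by simpa using hsC)).const_add 1
        using 1
      field_simp
      ring
    have hc := ((hasDerivAt_id (1 + Complex.I * u / (2 * s) : ℂ)).cpow_const (c := (-(q : ℂ)))
      (hankelBase_mem_slitPlane s u)).comp s hb
    convert! hc.const_mul ((Real.exp (-u) * u ^ p : ℝ) : ℂ) using 1
    simp only [id]
    rw [Real.rpow_add_one (ne_of_gt hu)]
    push_cast
    rw [show (-(q : ℂ) - 1) = -((q : ℂ) + 1) by ring]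
    field_simp

/-- The factor in front of Hankel's integral. -/
def hankelFactor (t : ℝ) : ℂ :=
  (Real.sqrt (2 / (Real.pi * t)) : ℂ) * Complex.exp (Complex.I * (t - Real.pi / 4)) *
    ((Real.Gamma (1 / 2))⁻¹ : ℝ)

theorem hankelH0_eq (t : ℝ) :
    hankelH0 t = hankelFactor t * hankelIntegral (-(1 / 2)) (1 / 2) t := by
  simp only [hankelH0, hankelFactor, hankelIntegral]
  push_cast
  rfl

theorem hasDerivAt_hankelFactor {t : ℝ} (ht : 0 < t) :
    HasDerivAt hankelFactor ((Complex.I - 1 / (2 * t)) * hankelFactor t) t := by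
  have hpi := Real.pi_pos
  have hs : HasDerivAt (fun t : ℝ => Real.sqrt (2 / (Real.pi * t)))
      (-(1 / (2 * t)) * Real.sqrt (2 / (Real.pi * t))) t := by
    have h1 : HasDerivAt (fun t : ℝ => 2 / (Real.pi * t)) (-(2 / (Real.pi * t ^ 2))) t := by
      convert! (hasDerivAt_const t (2 : ℝ)).div ((hasDerivAt_id t).const_mul Real.pi)
        (mul_pos hpi ht).ne' using 1
      simp; field_simp
    convert! h1.sqrt (by positivity) using 1
    have h2 : Real.sqrt (2 / (Real.pi * t)) ≠ 0 := by positivity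
    have h3 : Real.sqrt (2 / (Real.pi * t)) ^ 2 = 2 / (Real.pi * t) := Real.sq_sqrt (by positivity)
    rw [eq_div_iff (by positivity)]
    calc _ = -(1 / t) * Real.sqrt (2 / (Real.pi * t)) ^ 2 := by ring
      _ = _ := by rw [h3]; field_simp
  have he : HasDerivAt (fun t : ℝ => Complex.exp (Complex.I * (t - Real.pi / 4)))
      (Complex.I * Complex.exp (Complex.I * (t - Real.pi / 4))) t := by
    have h1 : HasDerivAt (fun t : ℝ => (Complex.I * (t - Real.pi / 4) : ℂ)) Complex.I t := by
      simpa using ((HasDerivAt.ofReal_comp (hasDerivAt_id t)).sub_const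
        (Real.pi / 4 : ℂ)).const_mul Complex.I
    simpa [mul_comm] using h1.cexp
  convert! (hs.ofReal_comp.mul he).mul_const (((Real.Gamma (1 / 2))⁻¹ : ℝ) : ℂ) using 1
  simp only [hankelFactor]
  push_cast
  ring

theorem norm_hankelFactor {t : ℝ} (ht : 0 < t) :
    ‖hankelFactor t‖ = Real.sqrt (2 / Real.pi) * (Real.Gamma (1 / 2))⁻¹ * (Real.sqrt t)⁻¹ := by
  have h : (Complex.I * (t - Real.pi / 4) : ℂ) = ((t - Real.pi / 4 : ℝ) : ℂ) * Complex.I := by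
    push_cast; ring
  have hG : 0 < Real.Gamma (1 / 2) := Real.Gamma_pos_of_pos (by norm_num)
  rw [hankelFactor, norm_mul, norm_mul, h, Complex.norm_exp_ofReal_mul_I, Complex.norm_real,
    Complex.norm_real, Real.norm_of_nonneg (by positivity), Real.norm_of_nonneg (by positivity),
    ← div_div, Real.sqrt_div' _ ht.le]
  field_simp

/-- The derivative of the amplitude in `hankelH0`. -/
def hankelAmp1 (t : ℝ) : ℂ := Complex.I / (4 * t ^ 2) * hankelIntegral (1 / 2) (3 / 2) t

/-- The derivative of `hankelH0`. -/
def hankelD1 (t : ℝ) : ℂ :=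
  hankelFactor t *
    ((Complex.I - 1 / (2 * t)) * hankelIntegral (-(1 / 2)) (1 / 2) t + hankelAmp1 t)

/-- The second derivative of the amplitude in `hankelH0`. -/
def hankelAmp2 (t : ℝ) : ℂ :=
  -(Complex.I / (2 * t ^ 3)) * hankelIntegral (1 / 2) (3 / 2) t +
    Complex.I / (4 * t ^ 2) * (3 * Complex.I / (4 * t ^ 2) * hankelIntegral (3 / 2) (5 / 2) t)

/-- The second derivative of `hankelH0`. -/
def hankelD2 (t : ℝ) : ℂ :=
  hankelFactor t *
    ((Complex.I - 1 / (2 * t)) *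
        ((Complex.I - 1 / (2 * t)) * hankelIntegral (-(1 / 2)) (1 / 2) t + hankelAmp1 t) +
      1 / (2 * t ^ 2) * hankelIntegral (-(1 / 2)) (1 / 2) t +
      (Complex.I - 1 / (2 * t)) * hankelAmp1 t + hankelAmp2 t)

theorem hasDerivAt_hankelAmp {t : ℝ} (ht : 0 < t) :
    HasDerivAt (hankelIntegral (-(1 / 2)) (1 / 2)) (hankelAmp1 t) t := by
  have h := hasDerivAt_hankelIntegral (p := -(1 / 2)) (q := 1 / 2) (by norm_num) (by norm_num) ht
  rw [show (-(1 / 2) + 1 : ℝ) = 1 / 2 by norm_num,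
    show (1 / 2 + 1 : ℝ) = 3 / 2 by norm_num] at h
  convert! h using 1
  rw [hankelAmp1]
  push_cast
  ring

theorem hasDerivAt_hankelAmp1 {t : ℝ} (ht : 0 < t) :
    HasDerivAt hankelAmp1 (hankelAmp2 t) t := by
  have h := hasDerivAt_hankelIntegral (p := 1 / 2) (q := 3 / 2) (by norm_num) (by norm_num) ht
  rw [show (1 / 2 + 1 : ℝ) = 3 / 2 by norm_num,
    show (3 / 2 + 1 : ℝ) = 5 / 2 by norm_num] at h
  have htC : (t : ℂ) ≠ 0 := by exact_mod_cast ht.ne'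
  have h1 : HasDerivAt (fun t : ℝ => (Complex.I / (4 * t ^ 2) : ℂ))
      (-(Complex.I / (2 * t ^ 3))) t := by
    have h2 : HasDerivAt (fun t : ℝ => (4 * t ^ 2 : ℂ)) (4 * (2 * t)) t := by
      simpa using ((HasDerivAt.ofReal_comp (hasDerivAt_id t)).pow 2).const_mul (4 : ℂ)
    convert! (hasDerivAt_const t Complex.I).div h2 (by simpa using htC) using 1
    field_simp
    ring
  convert! h1.mul h using 1
  rw [hankelAmp2]
  push_cast
  ring

theorem hasDerivAt_hankelH0 {t : ℝ} (ht : 0 < t) : HasDerivAt hankelH0 (hankelD1 t) t := by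
  rw [show hankelH0 = fun t => hankelFactor t * hankelIntegral (-(1 / 2)) (1 / 2) t from
    funext hankelH0_eq]
  convert! (hasDerivAt_hankelFactor ht).mul (hasDerivAt_hankelAmp ht) using 1
  rw [hankelD1]
  ring

theorem hasDerivAt_hankelD1 {t : ℝ} (ht : 0 < t) : HasDerivAt hankelD1 (hankelD2 t) t := by
  have htC : (t : ℂ) ≠ 0 := by exact_mod_cast ht.ne'
  have h1 : HasDerivAt (fun t : ℝ => (Complex.I - 1 / (2 * t) : ℂ)) (1 / (2 * t ^ 2)) t := by
    have h2 : HasDerivAt (fun t : ℝ => (2 * t : ℂ)) 2 t := by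
      simpa using (HasDerivAt.ofReal_comp (hasDerivAt_id t)).const_mul (2 : ℂ)
    convert! ((hasDerivAt_const t (1 : ℂ)).div h2 (by simpa using htC)).const_sub Complex.I using 1
    field_simp
    ring
  convert! (hasDerivAt_hankelFactor ht).mul
    ((h1.mul (hasDerivAt_hankelAmp ht)).add (hasDerivAt_hankelAmp1 ht)) using 1
  simp only [hankelD2, Pi.add_apply, Pi.mul_apply]
  ring

/-- The rate is sharp at infinity. At zero it is weaker than the true logarithm but still integrable
along a curve. -/
theorem exists_hankelH0_bound : ∃ C, 0 ≤ C ∧ ∀ t, 0 < t → ‖hankelH0 t‖ ≤ C * (Real.sqrt t)⁻¹ := by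
  have hG : 0 < Real.Gamma (1 / 2) := Real.Gamma_pos_of_pos (by norm_num)
  refine ⟨Real.sqrt (2 / Real.pi), by positivity, fun t ht => ?_⟩
  rw [hankelH0_eq, norm_mul, norm_hankelFactor ht]
  have h := norm_hankelIntegral_le (p := -(1 / 2)) (q := 1 / 2) (by norm_num) (by norm_num) t
  rw [show (-(1 / 2) + 1 : ℝ) = 1 / 2 by norm_num] at h
  calc _ ≤ Real.sqrt (2 / Real.pi) * (Real.Gamma (1 / 2))⁻¹ * (Real.sqrt t)⁻¹ *
        Real.Gamma (1 / 2) := by gcongr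
    _ = _ := by field_simp

theorem norm_I_sub_le {t : ℝ} (ht : 0 < t) :
    ‖(Complex.I - 1 / (2 * t) : ℂ)‖ ≤ 1 + 1 / t := by
  refine (norm_sub_le _ _).trans ?_
  rw [Complex.norm_I, norm_div, norm_one, norm_mul, Complex.norm_real, Complex.norm_two,
    Real.norm_of_nonneg ht.le]
  gcongr
  linarith

theorem norm_hankelAmp1_le {t : ℝ} (ht : 0 < t) :
    ‖hankelAmp1 t‖ ≤ Real.Gamma (1 / 2) * (1 / t) := by
  have h := norm_hankelIntegral_succ_le (p := -(1 / 2)) (q := 1 / 2) (by norm_num) (by norm_num) ht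
  rw [show (-(1 / 2) + 1 : ℝ) = 1 / 2 by norm_num, show (1 / 2 + 1 : ℝ) = 3 / 2 by norm_num] at h
  have hG : 0 < Real.Gamma (1 / 2) := Real.Gamma_pos_of_pos (by norm_num)
  rw [hankelAmp1, norm_mul, norm_div, norm_mul, norm_pow, Complex.norm_real, Complex.norm_I,
    Real.norm_of_nonneg ht.le, show ‖(4 : ℂ)‖ = 4 by simp]
  calc _ ≤ 1 / (4 * t ^ 2) * (2 * t * Real.Gamma (1 / 2)) := by gcongr
    _ = Real.Gamma (1 / 2) * (1 / (2 * t)) := by field_simp; norm_num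
    _ ≤ _ := by gcongr; linarith

/-- The behaviour `t^(-3/2)` at zero is tolerable because the double-layer kernel gains a factor `|r
- r'|` from the geometry. -/
theorem exists_hankelD1_bound :
    ∃ C, 0 ≤ C ∧ ∀ t, 0 < t → ‖hankelD1 t‖ ≤ C * (1 + 1 / t) * (Real.sqrt t)⁻¹ := by
  have hG : 0 < Real.Gamma (1 / 2) := Real.Gamma_pos_of_pos (by norm_num)
  refine ⟨Real.sqrt (2 / Real.pi) * 2, by positivity, fun t ht => ?_⟩
  rw [hankelD1, norm_mul, norm_hankelFactor ht]
  have h := norm_hankelIntegral_le (p := -(1 / 2)) (q := 1 / 2) (by norm_num) (by norm_num) t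
  rw [show (-(1 / 2) + 1 : ℝ) = 1 / 2 by norm_num] at h
  have h2 : ‖(Complex.I - 1 / (2 * t)) * hankelIntegral (-(1 / 2)) (1 / 2) t + hankelAmp1 t‖ ≤
      (1 + 1 / t) * Real.Gamma (1 / 2) + Real.Gamma (1 / 2) * (1 / t) := by
    refine (norm_add_le _ _).trans (add_le_add ?_ (norm_hankelAmp1_le ht))
    rw [norm_mul]
    exact mul_le_mul (norm_I_sub_le ht) h (norm_nonneg _) (by positivity)
  have h3 : (1 + 1 / t) * Real.Gamma (1 / 2) + Real.Gamma (1 / 2) * (1 / t) ≤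
      2 * (1 + 1 / t) * Real.Gamma (1 / 2) := by nlinarith
  calc _ ≤ Real.sqrt (2 / Real.pi) * (Real.Gamma (1 / 2))⁻¹ * (Real.sqrt t)⁻¹ *
        (2 * (1 + 1 / t) * Real.Gamma (1 / 2)) := by gcongr; exact h2.trans h3
    _ = _ := by field_simp

/-- The second derivative is needed only in the tail of the lattice sum, so arguments near zero are
excluded and every negative power of `t` may be replaced by its value at `t₀`. -/
theorem exists_hankelD2_bound {t₀ : ℝ} (ht₀ : 0 < t₀) :
    ∃ C, 0 ≤ C ∧ ∀ t, t₀ ≤ t → ‖hankelD2 t‖ ≤ C * (Real.sqrt t)⁻¹ := by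
  have hG : 0 < Real.Gamma (1 / 2) := Real.Gamma_pos_of_pos (by norm_num)
  have hG1 : 0 < Real.Gamma (1 / 2 + 1) := Real.Gamma_pos_of_pos (by norm_num)
  have hG2 : 0 < Real.Gamma (3 / 2 + 1) := Real.Gamma_pos_of_pos (by norm_num)
  set a := 1 + 1 / t₀
  set G := Real.Gamma (1 / 2)
  set A := G * (1 / t₀)
  refine ⟨Real.sqrt (2 / Real.pi) * G⁻¹ * (a * (a * G + A) + 1 / (2 * t₀ ^ 2) * G + a * A +
    (1 / (2 * t₀ ^ 3) * Real.Gamma (1 / 2 + 1) +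
      1 / (4 * t₀ ^ 2) * (3 / (4 * t₀ ^ 2) * Real.Gamma (3 / 2 + 1)))),
    by positivity, fun t ht => ?_⟩
  have ht0 : 0 < t := ht₀.trans_le ht
  have h := norm_hankelIntegral_le (p := -(1 / 2)) (q := 1 / 2) (by norm_num) (by norm_num) t
  rw [show (-(1 / 2) + 1 : ℝ) = 1 / 2 by norm_num] at h
  have hJ1 := norm_hankelIntegral_le (p := 1 / 2) (q := 3 / 2) (by norm_num) (by norm_num) t
  have hJ2 := norm_hankelIntegral_le (p := 3 / 2) (q := 5 / 2) (by norm_num) (by norm_num) t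
  have ha : ‖(Complex.I - 1 / (2 * t) : ℂ)‖ ≤ a :=
    (norm_I_sub_le ht0).trans (by simp only [a]; gcongr)
  have hA : ‖hankelAmp1 t‖ ≤ A :=
    (norm_hankelAmp1_le ht0).trans (by simp only [A]; gcongr)
  have hA2 : ‖hankelAmp2 t‖ ≤ 1 / (2 * t₀ ^ 3) * Real.Gamma (1 / 2 + 1) +
      1 / (4 * t₀ ^ 2) * (3 / (4 * t₀ ^ 2) * Real.Gamma (3 / 2 + 1)) := by
    refine (norm_add_le _ _).trans ?_
    simp only [norm_mul, norm_neg, norm_div, norm_pow, Complex.norm_I, Complex.norm_real,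
      Real.norm_of_nonneg ht0.le, Complex.norm_ofNat, mul_one]
    gcongr
  have h2 : ‖(1 / (2 * t ^ 2) : ℂ)‖ ≤ 1 / (2 * t₀ ^ 2) := by
    simp only [norm_mul, norm_div, norm_pow, norm_one, Complex.norm_real,
      Real.norm_of_nonneg ht0.le, Complex.norm_ofNat]
    gcongr
  rw [hankelD2, norm_mul, norm_hankelFactor ht0, mul_right_comm]
  gcongr
  refine (norm_add_le _ _).trans (add_le_add ?_ hA2)
  refine (norm_add_le _ _).trans (add_le_add ?_ ?_)
  · refine (norm_add_le _ _).trans (add_le_add ?_ ?_)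
    · rw [norm_mul]
      gcongr
      refine (norm_add_le _ _).trans (add_le_add ?_ hA)
      rw [norm_mul]
      gcongr
    · rw [norm_mul]
      gcongr
  · rw [norm_mul]
    gcongr

theorem continuousOn_hankelH0 : ContinuousOn hankelH0 (Ioi 0) :=
  fun _ ht => (hasDerivAt_hankelH0 ht).continuousAt.continuousWithinAt

theorem continuousOn_hankelD1 : ContinuousOn hankelD1 (Ioi 0) :=
  fun _ ht => (hasDerivAt_hankelD1 ht).continuousAt.continuousWithinAt

/-! ### Weakly singular integral operators -/

section WeaklySingular

variable {X : Type*} [MetricSpace X]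

/-- A continuous cutoff that vanishes on `[0, ε]` and equals one on `[2 ε, ∞)`. -/
def cutoff (ε d : ℝ) : ℝ := max 0 (min 1 (d / ε - 1))

theorem continuous_cutoff (ε : ℝ) : Continuous (cutoff ε) := by
  unfold cutoff; fun_prop

theorem cutoff_of_le {ε d : ℝ} (hε : 0 < ε) (h : d ≤ ε) : cutoff ε d = 0 := by
  have : d / ε ≤ 1 := (div_le_one hε).mpr h
  rw [cutoff, max_eq_left]
  exact (min_le_right _ _).trans (by linarith)

theorem cutoff_of_ge {ε d : ℝ} (hε : 0 < ε) (h : 2 * ε ≤ d) : cutoff ε d = 1 := by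
  have : 2 ≤ d / ε := (le_div_iff₀ hε).mpr h
  rw [cutoff, min_eq_left (by linarith), max_eq_right zero_le_one]

theorem norm_one_sub_cutoff_le (ε d : ℝ) : ‖(1 - cutoff ε d : ℂ)‖ ≤ 1 := by
  rw [← Complex.ofReal_one, ← Complex.ofReal_sub, Complex.norm_real, Real.norm_eq_abs, abs_le]
  have h0 : 0 ≤ cutoff ε d := le_max_left _ _
  have h1 : cutoff ε d ≤ 1 := max_le zero_le_one (min_le_left _ _)
  constructor <;> linarith

theorem exists_small_truncation_error (C : ℝ) {η : ℝ} (hη : 0 < η) :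
    ∃ ε : ℝ, 0 < ε ∧ C * Real.sqrt (2 * ε) < η := by
  have h1 : Tendsto (fun ε : ℝ => C * Real.sqrt (2 * ε)) (𝓝[>] 0) (𝓝 0) := by
    have : Continuous fun ε : ℝ => C * Real.sqrt (2 * ε) := by fun_prop
    simpa using (this.tendsto 0).mono_left nhdsWithin_le_nhds
  obtain ⟨ε, h2, h3⟩ := ((h1.eventually_lt_const hη).and self_mem_nhdsWithin).exists
  exact ⟨ε, h3, h2⟩

/-- A family of kernels, continuous off the diagonal together with the parameter, with a singularity
of order at most `1 / 2` on the diagonal. -/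
structure WeaklySingular (S : Set ℝ) (K : ℝ → X → X → ℂ) : Prop where
  continuousOn : ContinuousOn (fun q : ℝ × X × X => K q.1 q.2.1 q.2.2)
    {q | q.1 ∈ S ∧ q.2.1 ≠ q.2.2}
  bound : ∃ C : ℝ, ∀ k ∈ S, ∀ x y, x ≠ y → ‖K k x y‖ ≤ C * (Real.sqrt (dist x y))⁻¹


namespace WeaklySingular

variable {S : Set ℝ} {K K' : ℝ → X → X → ℂ}

theorem exists_bound (hK : WeaklySingular S K) : ∃ C : ℝ, 0 ≤ C ∧
    ∀ k ∈ S, ∀ x y, x ≠ y → ‖K k x y‖ ≤ C * (Real.sqrt (dist x y))⁻¹ := by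
  obtain ⟨C, h⟩ := hK.bound
  refine ⟨max C 0, le_max_right _ _, fun k hk x y hxy => (h k hk x y hxy).trans ?_⟩
  gcongr
  exact le_max_left _ _

theorem congr (hK : WeaklySingular S K) (h : ∀ k ∈ S, ∀ x y, x ≠ y → K' k x y = K k x y) :
    WeaklySingular S K' where
  continuousOn := hK.continuousOn.congr fun q hq => h q.1 hq.1 _ _ hq.2
  bound := by
    obtain ⟨C, hC⟩ := hK.bound
    exact ⟨C, fun k hk x y hxy => by rw [h k hk x y hxy]; exact hC k hk x y hxy⟩

theorem add (hK : WeaklySingular S K) (hK' : WeaklySingular S K') :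
    WeaklySingular S fun k x y => K k x y + K' k x y where
  continuousOn := hK.continuousOn.add hK'.continuousOn
  bound := by
    obtain ⟨C, hC⟩ := hK.bound
    obtain ⟨C', hC'⟩ := hK'.bound
    refine ⟨C + C', fun k hk x y hxy => ?_⟩
    rw [add_mul]
    exact (norm_add_le _ _).trans (add_le_add (hC k hk x y hxy) (hC' k hk x y hxy))

theorem zero : WeaklySingular (X := X) S fun _ _ _ => 0 where
  continuousOn := continuousOn_const
  bound := ⟨0, by simp⟩

theorem sum {ι : Type*} (s : Finset ι) {K : ι → ℝ → X → X → ℂ}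
    (hK : ∀ i ∈ s, WeaklySingular S (K i)) :
    WeaklySingular S fun k x y => ∑ i ∈ s, K i k x y := by
  classical
  induction s using Finset.induction_on with
  | empty => simpa using zero
  | insert i s hi ih =>
    simp only [Finset.sum_insert hi]
    exact (hK i (Finset.mem_insert_self _ _)).add
      (ih fun i' hi' => hK i' (Finset.mem_insert_of_mem hi'))

theorem mul_left (hK : WeaklySingular S K) (hS : IsCompact S) {c : ℝ → ℂ} (hc : ContinuousOn c S) :
    WeaklySingular S fun k x y => c k * K k x y where
  continuousOn := (hc.comp continuousOn_fst fun _ hq => hq.1).mul hK.continuousOn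
  bound := by
    obtain ⟨C, hC0, hC⟩ := hK.exists_bound
    obtain ⟨B, hB⟩ := hS.exists_bound_of_continuousOn hc
    refine ⟨B * C, fun k hk x y hxy => ?_⟩
    rw [norm_mul, mul_assoc]
    exact mul_le_mul (hB k hk) (hC k hk x y hxy) (norm_nonneg _) ((norm_nonneg _).trans (hB k hk))

/-- A bounded kernel satisfies the singular bound because distances do not exceed the diameter. -/
theorem of_continuousOn [CompactSpace X] (hS : IsCompact S)
    (hK : ContinuousOn (fun q : ℝ × X × X => K q.1 q.2.1 q.2.2) (S ×ˢ univ)) :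
    WeaklySingular S K where
  continuousOn := hK.mono fun q hq => ⟨hq.1, mem_univ _⟩
  bound := by
    obtain ⟨B, hB⟩ := (hS.prod isCompact_univ).exists_bound_of_continuousOn hK
    refine ⟨B * Real.sqrt (Metric.diam (univ : Set X)), fun k hk x y hxy => ?_⟩
    have hd : 0 < Real.sqrt (dist x y) := Real.sqrt_pos.mpr (dist_pos.mpr hxy)
    have h1 : Real.sqrt (dist x y) ≤ Real.sqrt (Metric.diam (univ : Set X)) :=
      Real.sqrt_le_sqrt
        (Metric.dist_le_diam_of_mem isCompact_univ.isBounded (mem_univ x) (mem_univ y))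
    have h2 := hB (k, x, y) ⟨hk, mem_univ _⟩
    rw [← div_eq_mul_inv, le_div_iff₀ hd]
    exact mul_le_mul h2 h1 hd.le ((norm_nonneg _).trans h2)

theorem continuousOn_section (hK : WeaklySingular S K) {k : ℝ} (hk : k ∈ S) (x : X) :
    ContinuousOn (K k x) {x}ᶜ :=
  hK.continuousOn.comp (f := fun y => ((k, x, y) : ℝ × X × X)) (by fun_prop)
    fun _ hy => ⟨hk, fun h => hy h.symm⟩

/-- Where the distance is below `ε` the product vanishes on a whole neighbourhood, whatever the
values of `K` on the diagonal; elsewhere both factors are continuous. -/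
theorem continuous_truncation (hK : WeaklySingular S K) {ε : ℝ} (hε : 0 < ε) :
    Continuous fun q : S × X × X =>
      (cutoff ε (dist q.2.1 q.2.2) : ℂ) * K q.1 q.2.1 q.2.2 := by
  rw [continuous_iff_continuousAt]
  intro q
  have hd : Continuous fun q : S × X × X => dist q.2.1 q.2.2 := by fun_prop
  by_cases hq : dist q.2.1 q.2.2 < ε
  · have h0 : (fun q : S × X × X => (cutoff ε (dist q.2.1 q.2.2) : ℂ) * K q.1 q.2.1 q.2.2) =ᶠ[𝓝 q]
        fun _ => 0 := by
      filter_upwards [hd.continuousAt.eventually_lt_const hq] with p hp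
      rw [cutoff_of_le hε hp.le, Complex.ofReal_zero, zero_mul]
    exact continuousAt_const.congr h0.symm
  · have hpos : 0 < dist q.2.1 q.2.2 := hε.trans_le (not_lt.mp hq)
    refine ContinuousAt.mul ?_ ?_
    · exact (Complex.continuous_ofReal.comp ((continuous_cutoff ε).comp hd)).continuousAt
    · refine (hK.continuousOn ((q.1 : ℝ), q.2) ⟨q.1.2, dist_pos.mp hpos⟩).tendsto.comp
        (f := fun p : S × X × X => ((p.1 : ℝ), p.2)) ?_
      refine tendsto_nhdsWithin_iff.mpr ⟨?_, ?_⟩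
      · exact (Continuous.prodMk (by fun_prop) (by fun_prop)).tendsto q
      · filter_upwards [hd.continuousAt.eventually_const_lt hpos] with p hp
        exact ⟨p.1.2, dist_pos.mp hp⟩

/-- The kernels multiplied with a cutoff near the diagonal. -/
def truncation [CompactSpace X] (hK : WeaklySingular S K) {ε : ℝ} (hε : 0 < ε) :
    C(S, C(X × X, ℂ)) :=
  ContinuousMap.curry ⟨_, hK.continuous_truncation hε⟩

theorem truncation_apply [CompactSpace X] (hK : WeaklySingular S K) {ε : ℝ} (hε : 0 < ε) (k : S)
    (x y : X) : hK.truncation hε k (x, y) = (cutoff ε (dist x y) : ℂ) * K k x y := rfl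

end WeaklySingular

/-! ### Integration of weak singularities against upper regular measures. -/

variable [MeasurableSpace X]

/-- The measure of every ball is at most a constant times the radius. -/
def UpperRegular (μ : Measure X) : Prop :=
  ∃ C : ℝ, 0 ≤ C ∧ ∀ x ρ, 0 ≤ ρ → μ (Metric.closedBall x ρ) ≤ ENNReal.ofReal (C * ρ)

theorem UpperRegular.isFiniteMeasure [CompactSpace X] {μ : Measure X} (hμ : UpperRegular μ) :
    IsFiniteMeasure μ := by
  obtain ⟨C, -, h⟩ := hμ
  constructor
  rcases isEmpty_or_nonempty X with hX | ⟨⟨x⟩⟩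
  · simp [univ_eq_empty_iff.mpr hX]
  · have : (univ : Set X) ⊆ Metric.closedBall x (Metric.diam (univ : Set X)) := fun y _ =>
      Metric.dist_le_diam_of_mem isCompact_univ.isBounded (mem_univ y) (mem_univ x)
    exact ((measure_mono this).trans (h x _ Metric.diam_nonneg)).trans_lt ENNReal.ofReal_lt_top

/-- Radius zero is allowed in the definition, so there are no atoms and the values of a kernel on
the diagonal do not matter. -/
theorem UpperRegular.measure_singleton {μ : Measure X} (hμ : UpperRegular μ) (x : X) :
    μ {x} = 0 := by
  obtain ⟨C, -, h⟩ := hμ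
  have := h x 0 le_rfl
  simpa using this

theorem UpperRegular.ae_ne {μ : Measure X} (hμ : UpperRegular μ) (x : X) : ∀ᵐ y ∂μ, x ≠ y := by
  have := measure_eq_zero_iff_ae_notMem.mp (hμ.measure_singleton x)
  filter_upwards [this] with y hy h
  exact hy h.symm

/-- The ball is decomposed into shells with radii `ρ 4^(-m)`. On the shell `m` the integrand is at
most `2^(m+1) / √ρ` and the measure at most `C ρ 4^(-m)`, which leaves the geometric series `2 C √ρ
∑ 2^(-m) = 4 C √ρ`. -/
theorem UpperRegular.exists_lintegral_ball_le [OpensMeasurableSpace X] {μ : Measure X}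
    (hμ : UpperRegular μ) :
    ∃ C : ℝ, 0 ≤ C ∧ ∀ x ρ, 0 < ρ →
      ∫⁻ y in Metric.ball x ρ, ENNReal.ofReal (Real.sqrt (dist x y))⁻¹ ∂μ ≤
        ENNReal.ofReal (C * Real.sqrt ρ) := by
  obtain ⟨C, hC, h⟩ := hμ
  refine ⟨4 * C, by positivity, fun x ρ hρ => ?_⟩
  have hsq : 0 < Real.sqrt ρ := Real.sqrt_pos.mpr hρ
  have hpt : ∀ y ∈ Metric.ball x ρ, ENNReal.ofReal (Real.sqrt (dist x y))⁻¹ ≤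
      ∑' m : ℕ, (Metric.closedBall x (ρ * (1 / 4) ^ m)).indicator
        (fun _ => ENNReal.ofReal (2 ^ (m + 1) / Real.sqrt ρ)) y := by
    intro y hy
    -- At the centre the integrand is `0⁻¹ = 0`.
    rcases eq_or_ne x y with rfl | hxy
    · simp
    have hd : 0 < dist x y := dist_pos.mpr hxy
    rw [Metric.mem_ball, dist_comm] at hy
    obtain ⟨m, hm1, hm2⟩ := exists_nat_pow_near_of_lt_one (x := dist x y / ρ) (y := (1 / 4 : ℝ))
      (by positivity) ((div_le_one hρ).mpr hy.le) (by norm_num) (by norm_num)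
    refine le_trans ?_ (ENNReal.le_tsum m)
    rw [lt_div_iff₀ hρ] at hm1
    rw [div_le_iff₀ hρ] at hm2
    rw [indicator_of_mem (by rw [Metric.mem_closedBall, dist_comm]; linarith)]
    apply ENNReal.ofReal_le_ofReal
    have h1 : Real.sqrt ρ / 2 ^ (m + 1) ≤ Real.sqrt (dist x y) := by
      apply Real.le_sqrt_of_sq_le
      rw [div_pow, Real.sq_sqrt hρ.le, ← pow_mul, mul_comm (m + 1) 2, pow_mul]
      calc ρ / (2 ^ 2) ^ (m + 1) = (1 / 4) ^ (m + 1) * ρ := by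
            rw [one_div, inv_pow, show (2 : ℝ) ^ 2 = 4 by norm_num, div_eq_inv_mul]
        _ ≤ _ := hm1.le
    calc (Real.sqrt (dist x y))⁻¹ ≤ (Real.sqrt ρ / 2 ^ (m + 1))⁻¹ := by gcongr
      _ = _ := inv_div _ _
  calc ∫⁻ y in Metric.ball x ρ, ENNReal.ofReal (Real.sqrt (dist x y))⁻¹ ∂μ
      ≤ ∫⁻ y in Metric.ball x ρ, ∑' m : ℕ, (Metric.closedBall x (ρ * (1 / 4) ^ m)).indicator
        (fun _ => ENNReal.ofReal (2 ^ (m + 1) / Real.sqrt ρ)) y ∂μ :=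
        setLIntegral_mono' Metric.isOpen_ball.measurableSet hpt
    _ ≤ ∫⁻ y, ∑' m : ℕ, (Metric.closedBall x (ρ * (1 / 4) ^ m)).indicator
        (fun _ => ENNReal.ofReal (2 ^ (m + 1) / Real.sqrt ρ)) y ∂μ := setLIntegral_le_lintegral _ _
    _ = ∑' m : ℕ, ENNReal.ofReal (2 ^ (m + 1) / Real.sqrt ρ) *
          μ (Metric.closedBall x (ρ * (1 / 4) ^ m)) := by
        rw [lintegral_tsum fun m => (measurable_const.indicator
          Metric.isClosed_closedBall.measurableSet).aemeasurable]
        congr 1 with m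
        rw [lintegral_indicator_const Metric.isClosed_closedBall.measurableSet]
    _ ≤ ∑' m : ℕ, ENNReal.ofReal (2 * C * Real.sqrt ρ * (1 / 2) ^ m) := by
        refine ENNReal.tsum_le_tsum fun m => ?_
        calc _ ≤ ENNReal.ofReal (2 ^ (m + 1) / Real.sqrt ρ) *
              ENNReal.ofReal (C * (ρ * (1 / 4) ^ m)) := by
                gcongr; exact h x _ (by positivity)
          _ = _ := by
            rw [← ENNReal.ofReal_mul (by positivity)]
            congr 1
            have h2 : (2 : ℝ) ^ m * (1 / 4) ^ m = (1 / 2) ^ m := by rw [← mul_pow]; norm_num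
            have h3 : ρ = Real.sqrt ρ * Real.sqrt ρ := (Real.mul_self_sqrt hρ.le).symm
            rw [← h2, div_mul_eq_mul_div, div_eq_iff hsq.ne']
            nth_rewrite 1 [h3]
            ring
    _ = ENNReal.ofReal (4 * C * Real.sqrt ρ) := by
        rw [← ENNReal.ofReal_tsum_of_nonneg (fun m => by positivity)
          (summable_geometric_two.mul_left _), tsum_mul_left, tsum_geometric_two]
        congr 1; ring

theorem UpperRegular.integrable_inv_sqrt_dist [BorelSpace X] [CompactSpace X] {μ : Measure X}
    (hμ : UpperRegular μ) (x : X) : Integrable (fun y => (Real.sqrt (dist x y))⁻¹) μ := by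
  have hm : Measurable fun y => (Real.sqrt (dist x y))⁻¹ := by fun_prop
  refine ⟨hm.aestronglyMeasurable, ?_⟩
  obtain ⟨C, hC, h⟩ := hμ.exists_lintegral_ball_le
  have hball : Metric.ball x (Metric.diam (univ : Set X) + 1) = univ :=
    eq_univ_of_forall fun y => by
      have := Metric.dist_le_diam_of_mem isCompact_univ.isBounded (mem_univ y) (mem_univ x)
      rw [Metric.mem_ball]
      linarith
  have := h x (Metric.diam (univ : Set X) + 1) (by positivity)
  rw [hball, Measure.restrict_univ] at this
  rw [hasFiniteIntegral_iff_norm]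
  refine lt_of_le_of_lt (le_of_eq ?_) (this.trans_lt ENNReal.ofReal_lt_top)
  refine lintegral_congr fun y => ?_
  rw [Real.norm_of_nonneg (by positivity)]

theorem UpperRegular.exists_integral_ball_le [BorelSpace X] {μ : Measure X}
    (hμ : UpperRegular μ) :
    ∃ C : ℝ, 0 ≤ C ∧ ∀ x ρ, 0 < ρ →
      ∫ y in Metric.ball x ρ, (Real.sqrt (dist x y))⁻¹ ∂μ ≤ C * Real.sqrt ρ := by
  obtain ⟨C, hC, h⟩ := hμ.exists_lintegral_ball_le
  refine ⟨C, hC, fun x ρ hρ => ?_⟩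
  have hm : Measurable fun y => (Real.sqrt (dist x y))⁻¹ := by fun_prop
  rw [integral_eq_lintegral_of_nonneg_ae (Eventually.of_forall fun y => by positivity)
    hm.aestronglyMeasurable]
  exact ENNReal.toReal_le_of_le_ofReal (by positivity) (h x ρ hρ)

/-- The integral operator of a continuous kernel. -/
def kernelOperator [CompactSpace X] [BorelSpace X] (μ : Measure X) [IsFiniteMeasure μ] :
    C(X × X, ℂ) →L[ℂ] C(X, ℂ) →L[ℂ] C(X, ℂ) :=
  LinearMap.mkContinuous₂
    (LinearMap.mk₂ ℂ
      (fun (K : C(X × X, ℂ)) (ψ : C(X, ℂ)) => (⟨fun x => ∫ y, K (x, y) * ψ y ∂μ, by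
        simpa using continuous_parametric_integral_of_continuous (μ := μ)
          (f := fun x y => K (x, y) * ψ y) (by fun_prop) isCompact_univ⟩ : C(X, ℂ)))
      (fun K K' ψ => by
        ext x
        simp only [ContinuousMap.coe_mk, ContinuousMap.add_apply, add_mul]
        exact integral_add ((Continuous.integrable_of_hasCompactSupport (by fun_prop)
          (HasCompactSupport.of_compactSpace _)))
          ((Continuous.integrable_of_hasCompactSupport (by fun_prop)
          (HasCompactSupport.of_compactSpace _))))
      (fun c K ψ => by
        ext x
        simp only [ContinuousMap.coe_mk, ContinuousMap.smul_apply, smul_eq_mul, mul_assoc]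
        exact integral_const_mul _ _)
      (fun K ψ ψ' => by
        ext x
        simp only [ContinuousMap.coe_mk, ContinuousMap.add_apply, mul_add]
        exact integral_add ((Continuous.integrable_of_hasCompactSupport (by fun_prop)
          (HasCompactSupport.of_compactSpace _)))
          ((Continuous.integrable_of_hasCompactSupport (by fun_prop)
          (HasCompactSupport.of_compactSpace _))))
      (fun c K ψ => by
        ext x
        simp only [ContinuousMap.coe_mk, ContinuousMap.smul_apply, smul_eq_mul,
          mul_left_comm _ c]
        exact integral_const_mul _ _))
    (μ.real univ) fun K ψ => by
      refine (ContinuousMap.norm_le _ (by positivity)).mpr fun x => ?_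
      refine (norm_integral_le_of_norm_le_const (C := ‖K‖ * ‖ψ‖)
        (Eventually.of_forall fun y => ?_)).trans (le_of_eq (by ring))
      rw [norm_mul]
      exact mul_le_mul (K.norm_coe_le_norm _) (ψ.norm_coe_le_norm _) (norm_nonneg _) (norm_nonneg _)

theorem kernelOperator_apply [CompactSpace X] [BorelSpace X] (μ : Measure X) [IsFiniteMeasure μ]
    (K : C(X × X, ℂ)) (ψ : C(X, ℂ)) (x : X) :
    kernelOperator μ K ψ x = ∫ y, K (x, y) * ψ y ∂μ := rfl

namespace WeaklySingular

variable {S : Set ℝ} {K : ℝ → X → X → ℂ}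

theorem integrable [BorelSpace X] [CompactSpace X] {μ : Measure X} (hμ : UpperRegular μ)
    (hK : WeaklySingular S K) {k : ℝ} (hk : k ∈ S) (x : X) (ψ : C(X, ℂ)) :
    Integrable (fun y => K k x y * ψ y) μ := by
  obtain ⟨C, hC0, hC⟩ := hK.exists_bound
  refine ((hμ.integrable_inv_sqrt_dist x).const_mul (C * ‖ψ‖)).mono' ?_ ?_
  · have h1 : AEStronglyMeasurable (fun y => K k x y * ψ y) (μ.restrict {x}ᶜ) :=
      ((hK.continuousOn_section hk x).mul ψ.continuous.continuousOn).aestronglyMeasurable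
        (measurableSet_singleton x).compl
    rwa [Measure.restrict_eq_self_of_ae_mem] at h1
    filter_upwards [hμ.ae_ne x] with y hy h
    exact hy h.symm
  · filter_upwards [hμ.ae_ne x] with y hy
    rw [norm_mul, mul_right_comm]
    exact mul_le_mul (hC k hk x y hy) (ψ.norm_coe_le_norm y) (norm_nonneg _) (by positivity)

/-- The cutoff changes the kernel only within distance `2 ε` of the diagonal, where the integral of
the singularity is `O(√(2 ε))`. The constant depends on neither `k` nor `x`, so the estimate holds
in operator norm uniformly in the frequency. -/
theorem exists_truncation_error [BorelSpace X] [CompactSpace X] {μ : Measure X}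
    [IsFiniteMeasure μ] (hμ : UpperRegular μ) (hK : WeaklySingular S K) :
    ∃ C, 0 ≤ C ∧ ∀ (ε : ℝ) (hε : 0 < ε) (k : S) (ψ : C(X, ℂ)) (x : X),
      ‖∫ y, K k x y * ψ y ∂μ - kernelOperator μ (hK.truncation hε k) ψ x‖ ≤
        C * Real.sqrt (2 * ε) * ‖ψ‖ := by
  obtain ⟨C, hC0, hC⟩ := hK.exists_bound
  obtain ⟨B, hB0, hB⟩ := hμ.exists_integral_ball_le
  refine ⟨C * B, by positivity, fun ε hε k ψ x => ?_⟩
  have hint : Integrable (fun y => hK.truncation hε k (x, y) * ψ y) μ :=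
    Continuous.integrable_of_hasCompactSupport (by fun_prop) (HasCompactSupport.of_compactSpace _)
  rw [kernelOperator_apply, ← integral_sub (hK.integrable hμ k.2 x ψ) hint]
  have hg : Integrable (fun y => (Metric.ball x (2 * ε)).indicator
      (fun y => C * ‖ψ‖ * (Real.sqrt (dist x y))⁻¹) y) μ :=
    ((hμ.integrable_inv_sqrt_dist x).const_mul _).indicator Metric.isOpen_ball.measurableSet
  refine (norm_integral_le_of_norm_le hg ?_).trans ?_
  · filter_upwards [hμ.ae_ne x] with y hy
    rw [truncation_apply, ← sub_mul, ← one_sub_mul, norm_mul, norm_mul]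
    by_cases hb : y ∈ Metric.ball x (2 * ε)
    · rw [indicator_of_mem hb]
      calc _ ≤ 1 * (C * (Real.sqrt (dist x y))⁻¹) * ‖ψ‖ :=
            mul_le_mul (mul_le_mul (norm_one_sub_cutoff_le _ _) (hC k k.2 x y hy) (norm_nonneg _)
              zero_le_one) (ψ.norm_coe_le_norm y) (norm_nonneg _) (by positivity)
        _ = _ := by ring
    · rw [indicator_of_notMem hb]
      rw [Metric.mem_ball, not_lt, dist_comm] at hb
      simp [cutoff_of_ge hε hb]
  · rw [integral_indicator Metric.isOpen_ball.measurableSet, integral_const_mul]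
    calc _ ≤ C * ‖ψ‖ * (B * Real.sqrt (2 * ε)) := by
          gcongr; exact hB x (2 * ε) (by positivity)
      _ = _ := by ring

/-- A weakly singular family of kernels defines a family of bounded operators on the continuous
functions that depends continuously on the parameter. -/
theorem exists_operator [BorelSpace X] [CompactSpace X] {μ : Measure X} (hμ : UpperRegular μ)
    (hK : WeaklySingular S K) :
    ∃ T : ℝ → C(X, ℂ) →L[ℂ] C(X, ℂ),
      (∀ k ∈ S, ∀ ψ x, T k ψ x = ∫ y, K k x y * ψ y ∂μ) ∧ ContinuousOn T S := by
  classical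
  have := hμ.isFiniteMeasure
  obtain ⟨C, hC0, hC⟩ := hK.exists_truncation_error hμ
  -- The image of `ψ` is a uniform limit of its images under the truncated operators, which are
  -- continuous functions.
  have hcont : ∀ (k : S) (ψ : C(X, ℂ)), Continuous fun x => ∫ y, K k x y * ψ y ∂μ := by
    intro k ψ
    refine continuous_of_uniform_approx_of_continuous fun u hu => ?_
    obtain ⟨η, hη, hηu⟩ := Metric.mem_uniformity_dist.mp hu
    obtain ⟨ε, hε, hlt⟩ := exists_small_truncation_error (C * ‖ψ‖) hη
    refine ⟨kernelOperator μ (hK.truncation hε k) ψ, ContinuousMap.continuous _, fun x => hηu ?_⟩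
    rw [dist_eq_norm]
    exact (hC ε hε k ψ x).trans_lt (by rwa [mul_right_comm])
  -- Any fixed truncation gives boundedness; `ε = 1` is used.
  have hbound : ∀ (k : S) (ψ : C(X, ℂ)) (x : X), ‖∫ y, K k x y * ψ y ∂μ‖ ≤
      (C * Real.sqrt (2 * 1) + ‖kernelOperator μ (hK.truncation one_pos k)‖) * ‖ψ‖ := by
    intro k ψ x
    have h1 := hC 1 one_pos k ψ x
    have h2 := ((kernelOperator μ (hK.truncation one_pos k) ψ).norm_coe_le_norm x).trans
      (ContinuousLinearMap.le_opNorm _ _)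
    rw [add_mul]
    have h3 := norm_add_le (∫ y, K k x y * ψ y ∂μ - kernelOperator μ (hK.truncation one_pos k) ψ x)
      (kernelOperator μ (hK.truncation one_pos k) ψ x)
    rw [sub_add_cancel] at h3
    linarith
  let T : S → C(X, ℂ) →L[ℂ] C(X, ℂ) := fun k =>
    LinearMap.mkContinuous
      { toFun := fun ψ => ⟨fun x => ∫ y, K k x y * ψ y ∂μ, hcont k ψ⟩
        map_add' := fun ψ ψ' => by
          ext x
          simp only [ContinuousMap.coe_mk, ContinuousMap.add_apply, mul_add]
          exact integral_add (hK.integrable hμ k.2 x ψ) (hK.integrable hμ k.2 x ψ')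
        map_smul' := fun c ψ => by
          ext x
          simp only [ContinuousMap.coe_mk, ContinuousMap.smul_apply, smul_eq_mul, mul_left_comm _ c,
            RingHom.id_apply]
          exact integral_const_mul _ _ }
      (C * Real.sqrt (2 * 1) + ‖kernelOperator μ (hK.truncation one_pos k)‖) fun ψ =>
        (ContinuousMap.norm_le _ (by positivity)).mpr (hbound k ψ)
  -- The same approximation, now in operator norm: `kernelOperator μ` is continuous and linear in
  -- the kernel, and the truncated kernel is a continuous function of `k` in the maximum norm.
  have hT : Continuous T := by
    refine continuous_of_uniform_approx_of_continuous fun u hu => ?_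
    obtain ⟨η, hη, hηu⟩ := Metric.mem_uniformity_dist.mp hu
    obtain ⟨ε, hε, hlt⟩ := exists_small_truncation_error C hη
    refine ⟨fun k => kernelOperator μ (hK.truncation hε k),
      (kernelOperator μ).continuous.comp (hK.truncation hε).continuous, fun k => hηu ?_⟩
    rw [dist_eq_norm]
    refine lt_of_le_of_lt (ContinuousLinearMap.opNorm_le_bound _ (by positivity) fun ψ => ?_) hlt
    exact (ContinuousMap.norm_le _ (by positivity)).mpr (hC ε hε k ψ)
  -- The extension by zero outside `S` is arbitrary; only the restriction to `S` is asserted to be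
  -- continuous.
  refine ⟨fun k => if h : k ∈ S then T ⟨k, h⟩ else 0, fun k hk ψ x => ?_, ?_⟩
  · simp only [hk, dif_pos]
    rfl
  · rw [continuousOn_iff_continuous_domRestrict]
    convert hT using 1
    ext1 k
    simp

end WeaklySingular

end WeaklySingular

/-! ### Geometry of a `C²` boundary -/

section Geometry

variable {D : Set Plane}

theorem HasC2Boundary.isOutwardUnitNormal (hD : HasC2Boundary D) {p : Plane}
    (hp : p ∈ frontier D) : IsOutwardUnitNormal D p (normal D p) := by
  have h := hD p hp
  rw [normal, dif_pos h]
  exact h.choose_spec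

theorem HasC2Boundary.norm_normal (hD : HasC2Boundary D) {p : Plane} (hp : p ∈ frontier D) :
    ‖normal D p‖ = 1 :=
  ((hD.isOutwardUnitNormal hp).side (d := 0)).1

/-- A negative value would make `q` an interior point, and a positive value would keep `D` away from
a neighbourhood of `q`. -/
theorem eq_zero_of_mem_frontier {φ : Plane → ℝ} {q : Plane} (hq : q ∈ frontier D)
    (hφ : ContinuousAt φ q) (h : ∀ᶠ q' in 𝓝 q, q' ∈ D ↔ φ q' ≤ 0) : φ q = 0 := by
  rcases lt_trichotomy (φ q) 0 with hlt | h0 | hgt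
  · refine absurd ?_ hq.2
    rw [mem_interior_iff_mem_nhds]
    filter_upwards [h, hφ.eventually_lt_const hlt] with q' h1 h2
    exact h1.mpr h2.le
  · exact h0
  · have h3 : ∀ᶠ q' in 𝓝 q, q' ∉ D := by
      filter_upwards [h, hφ.eventually_const_lt hgt] with q' h1 h2 h3
      exact absurd (h1.mp h3) (not_le.mpr h2)
    obtain ⟨q', h4, h5⟩ := ((mem_closure_iff_frequently.mp hq.1).and_eventually h3).exists
    exact absurd h4 h5

/-- Near a boundary point, the boundary is contained in the zero set of a function with a
non-vanishing Lipschitz continuous gradient, and the normal is the normalized gradient. -/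
theorem HasC2Boundary.exists_local (hD : HasC2Boundary D) {p : Plane} (hp : p ∈ frontier D) :
    ∃ (φ : Plane → ℝ) (ε : ℝ) (Λ : ℝ) (m : ℝ), 0 < ε ∧ 0 ≤ Λ ∧ 0 < m ∧
      (∀ q ∈ Metric.ball p ε, DifferentiableAt ℝ φ q) ∧ ContinuousAt (gradient φ) p ∧
      (∀ q ∈ Metric.ball p ε, m ≤ ‖gradient φ q‖) ∧
      (∀ q ∈ Metric.ball p ε, ∀ q' ∈ Metric.ball p ε,
        ‖fderiv ℝ φ q - fderiv ℝ φ q'‖ ≤ Λ * ‖q - q'‖) ∧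
      (∀ q ∈ frontier D ∩ Metric.ball p ε, φ q = 0 ∧
        normal D q = ‖gradient φ q‖⁻¹ • gradient φ q) := by
  obtain ⟨v, φ, hφ, h0, hg, hDφ, -⟩ := hD p hp
  have hfd : ContDiffAt ℝ 1 (fderiv ℝ φ) p := hφ.fderiv_right (by norm_num)
  obtain ⟨Λ, s, hs, hΛ⟩ := hfd.exists_lipschitzOnWith
  have hgc : ContinuousAt (gradient φ) p :=
    ((InnerProductSpace.toDual ℝ Plane).symm.continuous.continuousAt).comp hfd.continuousAt
  have hm : ∀ᶠ q in 𝓝 p, ‖gradient φ p‖ / 2 < ‖gradient φ q‖ :=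
    hgc.norm.eventually_const_lt (half_lt_self (norm_pos_iff.mpr hg))
  obtain ⟨ε, hε, hball⟩ := Metric.eventually_nhds_iff_ball.mp
    ((hm.and hs).and ((hφ.eventually (by simp)).and hDφ.eventually_nhds))
  have hgpos : 0 < ‖gradient φ p‖ := norm_pos_iff.mpr hg
  refine ⟨φ, ε, Λ, ‖gradient φ p‖ / 2, hε, Λ.2, half_pos hgpos,
    fun q hq => (hball q hq).2.1.differentiableAt (by norm_num), hgc,
    fun q hq => (hball q hq).1.1.le, fun q hq q' hq' => ?_, fun q hq => ?_⟩
  · have := hΛ.dist_le_mul q (hball q hq).1.2 q' (hball q' hq').1.2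
    rwa [dist_eq_norm, dist_eq_norm] at this
  · obtain ⟨⟨h1, -⟩, h2, h3⟩ := hball q hq.2
    have hz := eq_zero_of_mem_frontier hq.1 h2.continuousAt h3
    have hne : gradient φ q ≠ 0 := norm_pos_iff.mp ((half_pos hgpos).trans h1)
    -- The chosen normal at `q` may come from another defining function; uniqueness identifies it
    -- with the normalized gradient of `φ`.
    exact ⟨hz, (hD.isOutwardUnitNormal hq.1).unique ⟨φ, h2, hz, hne, h3, rfl⟩⟩

theorem HasC2Boundary.continuous_normal (hD : HasC2Boundary D) :
    Continuous fun r : frontier D => normal D r := by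
  rw [continuous_iff_continuousAt]
  intro r
  obtain ⟨φ, ε, Λ, m, hε, hΛ, hm, -, hgc, hgm, -, hn⟩ := hD.exists_local r.2
  have h0 : gradient φ r ≠ 0 :=
    norm_pos_iff.mp (hm.trans_le (hgm r (Metric.mem_ball_self hε)))
  have h1 : ContinuousAt (fun q => ‖gradient φ q‖⁻¹ • gradient φ q) (r : Plane) :=
    (hgc.norm.inv₀ (norm_ne_zero_iff.mpr h0)).smul hgc
  have h2 : ContinuousAt (fun q : frontier D => ‖gradient φ q‖⁻¹ • gradient φ q) r :=
    h1.comp continuous_subtype_val.continuousAt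
  refine h2.congr ?_
  filter_upwards [continuous_subtype_val.continuousAt.preimage_mem_nhds
    (Metric.ball_mem_nhds (r : Plane) hε)] with q hq
  exact (hn q ⟨q.2, hq⟩).2.symm

/-- Since `φ` vanishes at both points, its linear part at `r'` in the direction `r - r'` equals the
Taylor remainder up to sign, and this is quadratic because the derivative is Lipschitz. Dividing by
the gradient norm, at least `m`, turns the gradient into the normal. -/
theorem HasC2Boundary.exists_local_inner_le (hD : HasC2Boundary D) {p : Plane}
    (hp : p ∈ frontier D) : ∃ ε > 0, ∃ C : ℝ, ∀ r ∈ frontier D ∩ Metric.ball p ε,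
      ∀ r' ∈ frontier D ∩ Metric.ball p ε,
        |inner ℝ (normal D r') (r - r')| ≤ C * ‖r - r'‖ ^ 2 := by
  obtain ⟨φ, ε, Λ, m, hε, hΛ, hm, hd, -, hgm, hlip, hn⟩ := hD.exists_local hp
  refine ⟨ε, hε, m⁻¹ * Λ, fun r hr r' hr' => ?_⟩
  obtain ⟨hz, -⟩ := hn r hr
  obtain ⟨hz', hn'⟩ := hn r' hr'
  have hconv : Convex ℝ (Metric.ball p ε ∩ Metric.closedBall r' ‖r - r'‖) :=
    (convex_ball p ε).inter (convex_closedBall r' _)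
  have h1 := hconv.norm_image_sub_le_of_norm_hasFDerivWithin_le' (f := φ) (f' := fderiv ℝ φ)
    (φ := fderiv ℝ φ r') (C := Λ * ‖r - r'‖) (x := r') (y := r)
    (fun q hq => (hd q hq.1).hasFDerivAt.hasFDerivWithinAt)
    (fun q hq => (hlip q hq.1 r' hr'.2).trans (by
      gcongr; rw [← dist_eq_norm]; exact hq.2))
    ⟨hr'.2, Metric.mem_closedBall_self (norm_nonneg _)⟩
    ⟨hr.2, by rw [Metric.mem_closedBall, dist_eq_norm]⟩
  have h2 : fderiv ℝ φ r' (r - r') = inner ℝ (gradient φ r') (r - r') := by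
    simp [gradient]
  rw [hz, hz', h2, sub_zero, zero_sub, norm_neg, Real.norm_eq_abs] at h1
  rw [hn', real_inner_smul_left, abs_mul, abs_of_nonneg (by positivity)]
  calc _ ≤ m⁻¹ * (Λ * ‖r - r'‖ * ‖r - r'‖) := by
        gcongr; exact hgm r' hr'.2
    _ = _ := by ring

/-- Compactness of the set of pairs makes the constant global: near the diagonal the local estimate
applies, and away from it `|r - r'|` is bounded below, so the Cauchy–Schwarz inequality is enough.
-/
theorem HasC2Boundary.exists_inner_le (hD : HasC2Boundary D) (hc : IsCompact (frontier D)) :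
    ∃ C : ℝ, ∀ r ∈ frontier D, ∀ r' ∈ frontier D,
      |inner ℝ (normal D r') (r - r')| ≤ C * ‖r - r'‖ ^ 2 := by
  have key : ∃ C : ℝ, ∀ q ∈ frontier D ×ˢ frontier D,
      q ∈ frontier D ×ˢ frontier D →
      |inner ℝ (normal D q.2) (q.1 - q.2)| ≤ C * ‖q.1 - q.2‖ ^ 2 := by
    -- The neighbourhoods used below are not subsets of the boundary, so membership is kept as a
    -- hypothesis inside the predicate.
    refine IsCompact.induction_on (hc.prod hc) (p := fun s => ∃ C : ℝ, ∀ q ∈ s,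
      q ∈ frontier D ×ˢ frontier D →
      |inner ℝ (normal D q.2) (q.1 - q.2)| ≤ C * ‖q.1 - q.2‖ ^ 2) ⟨0, by simp⟩ ?_ ?_ ?_
    · rintro s t hst ⟨C, hC⟩
      exact ⟨C, fun q hq => hC q (hst hq)⟩
    · rintro s t ⟨C, hC⟩ ⟨C', hC'⟩
      refine ⟨max C C', fun q hq hqF => ?_⟩
      rcases hq with hq | hq
      · refine (hC q hq hqF).trans ?_
        gcongr; exact le_max_left _ _
      · refine (hC' q hq hqF).trans ?_
        gcongr; exact le_max_right _ _
    · rintro ⟨p, p'⟩ ⟨hp, hp'⟩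
      by_cases hpp : p = p'
      · subst hpp
        obtain ⟨ε, hε, C, hC⟩ := hD.exists_local_inner_le hp
        refine ⟨Metric.ball p ε ×ˢ Metric.ball p ε, mem_nhdsWithin_of_mem_nhds
          (prod_mem_nhds (Metric.ball_mem_nhds p hε) (Metric.ball_mem_nhds p hε)), C,
          fun q hq hqF => hC _ ⟨hqF.1, hq.1⟩ _ ⟨hqF.2, hq.2⟩⟩
      · have hd : 0 < ‖p - p'‖ := norm_pos_iff.mpr (sub_ne_zero.mpr hpp)
        have hcont : Continuous fun q : Plane × Plane => ‖q.1 - q.2‖ := by fun_prop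
        refine ⟨_, mem_nhdsWithin_of_mem_nhds
          (hcont.continuousAt.eventually_const_lt (half_lt_self hd)), 2 / ‖p - p'‖,
          fun q hq hqF => ?_⟩
        have hq : ‖p - p'‖ / 2 < ‖q.1 - q.2‖ := hq
        refine (abs_real_inner_le_norm _ _).trans ?_
        rw [hD.norm_normal hqF.2, one_mul, sq, ← mul_assoc]
        refine le_mul_of_one_le_left (norm_nonneg _) ?_
        rw [div_mul_eq_mul_div, le_div_iff₀ hd]
        linarith
  obtain ⟨C, hC⟩ := key
  exact ⟨C, fun r hr r' hr' => hC (r, r') ⟨hr, hr'⟩ ⟨hr, hr'⟩⟩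

/-- The function `f` serves as a bi-Lipschitz coordinate on `V`: it maps the set into an interval of
length `4 ρ`, and its inverse expands lengths at most by the factor `A`. -/
theorem hausdorffMeasure_inter_closedBall_le {X : Type*} [MetricSpace X] [MeasurableSpace X]
    [BorelSpace X] {V : Set X} {f : X → ℝ} {A : NNReal}
    (hanti : ∀ x ∈ V, ∀ y ∈ V, dist x y ≤ A * |f x - f y|)
    (hlip : ∀ x ∈ V, ∀ y ∈ V, |f x - f y| ≤ dist x y) (x : X) (ρ : ℝ) :
    Measure.hausdorffMeasure 1 (V ∩ Metric.closedBall x ρ) ≤ ENNReal.ofReal (A * 4 * ρ) := by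
  set s := V ∩ Metric.closedBall x ρ with hs
  have h1 : AntilipschitzWith A fun y : s => f y :=
    AntilipschitzWith.of_le_mul_dist fun y z => hanti y y.2.1 z z.2.1
  have h2 := h1.le_hausdorffMeasure_image zero_le_one univ
  have h3 := (isometry_subtype_coe (s := s)).hausdorffMeasure_image (d := 1)
    (Or.inl zero_le_one) univ
  rw [image_univ, Subtype.range_coe] at h3
  rw [h3]
  refine h2.trans ?_
  rcases s.eq_empty_or_nonempty with h0 | ⟨y, hy⟩
  · have : IsEmpty s := isEmpty_coe_sort.mpr h0
    simp [univ_eq_empty_iff.mpr this]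
  · have h4 : (fun y : s => f y) '' univ ⊆ Metric.closedBall (f y) (2 * ρ) := by
      rintro _ ⟨z, -, rfl⟩
      rw [Metric.mem_closedBall, Real.dist_eq]
      refine (hlip z z.2.1 y hy.1).trans ((dist_triangle_right _ _ x).trans ?_)
      have := Metric.mem_closedBall.mp z.2.2
      have := Metric.mem_closedBall.mp hy.2
      linarith
    rw [hausdorffMeasure_real]
    calc (A : ENNReal) ^ (1 : ℝ) * volume ((fun y : s => f y) '' univ)
        ≤ (A : ENNReal) ^ (1 : ℝ) * volume (Metric.closedBall (f y) (2 * ρ)) := by gcongr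
      _ = ENNReal.ofReal (A * 4 * ρ) := by
        rw [Real.volume_closedBall, ENNReal.rpow_one, ← ENNReal.ofReal_coe_nnreal,
          ← ENNReal.ofReal_mul A.coe_nonneg]
        congr 1; ring

theorem norm_sq_plane (z : Plane) : ‖z‖ ^ 2 = z 0 ^ 2 + z 1 ^ 2 := by
  rw [EuclideanSpace.norm_sq_eq, Fin.sum_univ_two]
  simp

theorem inner_plane (v z : Plane) : inner ℝ v z = v 0 * z 0 + v 1 * z 1 := by
  rw [PiLp.inner_apply, Fin.sum_univ_two]
  simp [mul_comm]

/-- Arc length on a compact `C²` boundary: balls have measure at most a constant times the radius. -/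
theorem HasC2Boundary.upperRegular_arcLength (hD : HasC2Boundary D) (hc : IsCompact (frontier D)) :
    UpperRegular (arcLength D) := by
  have : CompactSpace (frontier D) := isCompact_iff_compactSpace.mp hc
  obtain ⟨C, hC⟩ := hD.exists_inner_le hc
  have key : ∃ B : ℝ, 0 ≤ B ∧ ∀ x ρ, 0 ≤ ρ →
      arcLength D (univ ∩ Metric.closedBall x ρ) ≤ ENNReal.ofReal (B * ρ) := by
    refine IsCompact.induction_on (isCompact_univ (X := frontier D)) (p := fun s => ∃ B : ℝ, 0 ≤ B ∧
      ∀ x ρ, 0 ≤ ρ → arcLength D (s ∩ Metric.closedBall x ρ) ≤ ENNReal.ofReal (B * ρ))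
      ⟨0, le_rfl, by simp⟩ ?_ ?_ ?_
    · rintro s t hst ⟨B, hB0, hB⟩
      exact ⟨B, hB0, fun x ρ hρ => (measure_mono (inter_subset_inter_left _ hst)).trans (hB x ρ hρ)⟩
    · rintro s t ⟨B, hB0, hB⟩ ⟨B', hB0', hB'⟩
      refine ⟨B + B', by positivity, fun x ρ hρ => ?_⟩
      rw [union_inter_distrib_right, add_mul, ENNReal.ofReal_add (by positivity) (by positivity)]
      exact (measure_union_le _ _).trans (add_le_add (hB x ρ hρ) (hB' x ρ hρ))
    · intro p _
      have hv : ‖normal D p‖ = 1 := hD.norm_normal p.2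
      set v := normal D p with hvdef
      have hν : ∀ᶠ q : frontier D in 𝓝 p, ‖v - normal D q‖ < 1 / 4 := by
        have : Continuous fun q : frontier D => ‖v - normal D q‖ :=
          (continuous_const.sub hD.continuous_normal).norm
        exact this.continuousAt.eventually_lt_const (by simp [hvdef])
      -- The radius is chosen so that the curvature and the variation of the normal contribute at
      -- most `1/4` each. Then `|⟨v, z⟩| ≤ |z| / 2`, and the tangential component of a chord `z` is
      -- at least `|z| / 2`, whence `A = 2`.
      have hη : ∃ η : ℝ, 0 < η ∧ |C| * (2 * η) ≤ 1 / 4 := by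
        refine ⟨(8 * (|C| + 1))⁻¹, by positivity, ?_⟩
        rw [← mul_assoc, ← div_eq_mul_inv, div_le_div_iff₀ (by positivity) (by norm_num)]
        linarith [abs_nonneg C]
      obtain ⟨η, hη0, hη⟩ := hη
      refine ⟨_, mem_nhdsWithin_of_mem_nhds (hν.and (Metric.ball_mem_nhds p hη0)), 2 * 4,
        by norm_num, fun x ρ _ => ?_⟩
      refine hausdorffMeasure_inter_closedBall_le (A := 2)
        -- The coordinate along the tangent line at `p`.
        (f := fun r : frontier D => v 0 * (r : Plane) 1 - v 1 * (r : Plane) 0) ?_ ?_ x ρ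
      · rintro r ⟨-, hr⟩ r' ⟨hr'ν, hr'⟩
        rw [Subtype.dist_eq, dist_eq_norm]
        set z : Plane := (r : Plane) - r' with hz
        have hf : v 0 * (r : Plane) 1 - v 1 * (r : Plane) 0 -
            (v 0 * (r' : Plane) 1 - v 1 * (r' : Plane) 0) = v 0 * z 1 - v 1 * z 0 := by
          simp only [hz, PiLp.sub_apply]; ring
        rw [hf]
        have hzn : ‖z‖ ≤ 2 * η := by
          rw [hz, ← dist_eq_norm, ← Subtype.dist_eq]
          have h1 : dist r p < η := hr
          have h2 : dist r' p < η := hr'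
          linarith [dist_triangle_right r r' p]
        have h1 : |inner ℝ v z| ≤ 1 / 2 * ‖z‖ := by
          have e1 : inner ℝ v z = inner ℝ (normal D r') z + inner ℝ (v - normal D r') z := by
            rw [← inner_add_left]; simp
          have e2 : |inner ℝ (normal D r') z| ≤ |C| * (2 * η) * ‖z‖ := by
            refine (hC r r.2 r' r'.2).trans ?_
            rw [sq, mul_assoc |C|]
            have hCC := le_abs_self C
            have := abs_nonneg C
            gcongr
          have e3 : |inner ℝ (v - normal D r') z| ≤ 1 / 4 * ‖z‖ :=
            (abs_real_inner_le_norm _ _).trans (by gcongr)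
          rw [e1]
          refine (abs_add_le _ _).trans ?_
          nlinarith [norm_nonneg z]
        -- Pythagoras in the orthonormal frame of normal and tangent at `p`.
        have h2 : ‖z‖ ^ 2 = inner ℝ v z ^ 2 + (v 0 * z 1 - v 1 * z 0) ^ 2 := by
          have e1 := norm_sq_plane v
          rw [hv] at e1
          rw [norm_sq_plane, inner_plane]
          linear_combination (z 0 ^ 2 + z 1 ^ 2) * e1
        have h3 : inner ℝ v z ^ 2 ≤ (1 / 2 * ‖z‖) ^ 2 := sq_le_sq' (abs_le.mp h1).1 (abs_le.mp h1).2
        refine abs_le_of_sq_le_sq' ?_ (by positivity) |>.2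
        rw [mul_pow, sq_abs]
        push_cast
        nlinarith
      · intro r _ r' _
        rw [Subtype.dist_eq, dist_eq_norm]
        set z : Plane := (r : Plane) - r' with hz
        have hf : v 0 * (r : Plane) 1 - v 1 * (r : Plane) 0 -
            (v 0 * (r' : Plane) 1 - v 1 * (r' : Plane) 0) = v 0 * z 1 - v 1 * z 0 := by
          simp only [hz, PiLp.sub_apply]; ring
        rw [hf]
        refine abs_le_of_sq_le_sq ?_ (norm_nonneg _)
        have e1 := norm_sq_plane v
        rw [hv] at e1
        rw [norm_sq_plane]
        nlinarith [sq_nonneg (v 0 * z 0 + v 1 * z 1)]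
  obtain ⟨B, hB0, hB⟩ := key
  exact ⟨B, hB0, fun x ρ hρ => by simpa using hB x ρ hρ⟩

end Geometry

/-! ### The free-space Green function and its gradient -/

/-- The radial factor of the gradient of `freeGreen k`. -/
def greenSlope (k ρ : ℝ) : ℂ := Complex.I / 4 * (k * hankelD1 (k * ρ)) / ρ

/-- The gradient of `freeGreen k`. -/
def gradGreen (k : ℝ) (z : Plane) : Plane →L[ℝ] ℂ := (innerSL ℝ z).smulRight (greenSlope k ‖z‖)

theorem gradGreen_apply (k : ℝ) (z v : Plane) :
    gradGreen k z v = inner ℝ z v * greenSlope k ‖z‖ := by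
  simp [gradGreen]

theorem hasFDerivAt_freeGreen {k : ℝ} (hk : 0 < k) {z : Plane} (hz : z ≠ 0) :
    HasFDerivAt (freeGreen k) (gradGreen k z) z := by
  have hn : 0 < ‖z‖ := norm_pos_iff.mpr hz
  have h1 : HasFDerivAt (fun z : Plane => ‖z‖) ((1 / (2 * ‖z‖)) • (2 • innerSL ℝ z)) z := by
    have := ((hasStrictFDerivAt_norm_sq z).hasFDerivAt).sqrt (by positivity)
    simpa [Real.sqrt_sq] using! this
  have h2 := ((hasDerivAt_hankelH0 (mul_pos hk hn)).hasFDerivAt.comp z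
    (h1.const_mul k)).const_mul (Complex.I / 4)
  convert! h2 using 1
  ext v
  have hC : (‖z‖ : ℂ) ≠ 0 := by exact_mod_cast hn.ne'
  simp [gradGreen_apply, greenSlope]
  field_simp

theorem norm_freeGreen (k : ℝ) (z : Plane) : ‖freeGreen k z‖ = 1 / 4 * ‖hankelH0 (k * ‖z‖)‖ := by
  simp [freeGreen]

theorem norm_greenSlope {k ρ : ℝ} (hk : 0 < k) (hρ : 0 < ρ) :
    ‖greenSlope k ρ‖ = 1 / 4 * (k * ‖hankelD1 (k * ρ)‖) / ρ := by
  rw [greenSlope, norm_div, norm_mul, norm_div, norm_mul, Complex.norm_I, Complex.norm_real,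
    Complex.norm_real, Real.norm_of_nonneg hk.le, Real.norm_of_nonneg hρ.le, Complex.norm_ofNat]

theorem continuousOn_freeGreen :
    ContinuousOn (fun q : ℝ × Plane => freeGreen q.1 q.2) {q | 0 < q.1 ∧ q.2 ≠ 0} := by
  refine continuousOn_const.mul (continuousOn_hankelH0.comp (by fun_prop) ?_)
  rintro ⟨k, z⟩ ⟨hk, hz⟩
  exact mul_pos hk (norm_pos_iff.mpr hz)

theorem continuousOn_gradGreen :
    ContinuousOn (fun q : ℝ × Plane => gradGreen q.1 q.2) {q | 0 < q.1 ∧ q.2 ≠ 0} := by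
  have h1 : ContinuousOn (fun q : ℝ × Plane => hankelD1 (q.1 * ‖q.2‖)) {q | 0 < q.1 ∧ q.2 ≠ 0} := by
    refine continuousOn_hankelD1.comp (by fun_prop) ?_
    rintro ⟨k, z⟩ ⟨hk, hz⟩
    exact mul_pos hk (norm_pos_iff.mpr hz)
  have h2 : ContinuousOn (fun q : ℝ × Plane => greenSlope q.1 ‖q.2‖) {q | 0 < q.1 ∧ q.2 ≠ 0} := by
    refine ContinuousOn.div (continuousOn_const.mul (ContinuousOn.mul (by fun_prop) h1))
      (by fun_prop) ?_
    rintro ⟨k, z⟩ ⟨hk, hz⟩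
    exact_mod_cast norm_ne_zero_iff.mpr hz
  have h3 : ContinuousOn (fun q : ℝ × Plane =>
      ContinuousLinearMap.smulRightL ℝ Plane ℂ (innerSL ℝ q.2) (greenSlope q.1 ‖q.2‖))
      {q | 0 < q.1 ∧ q.2 ≠ 0} := by
    refine ContinuousOn.clm_apply (Continuous.continuousOn ?_) h2
    fun_prop
  exact h3

/-- The radial derivative of `greenSlope k`. -/
def greenSlopeDeriv (k ρ : ℝ) : ℂ :=
  Complex.I / 4 * (k ^ 2 * hankelD2 (k * ρ) / ρ - k * hankelD1 (k * ρ) / ρ ^ 2)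

theorem hasDerivAt_greenSlope {k ρ : ℝ} (hk : 0 < k) (hρ : 0 < ρ) :
    HasDerivAt (greenSlope k) (greenSlopeDeriv k ρ) ρ := by
  have hC : (ρ : ℂ) ≠ 0 := by exact_mod_cast hρ.ne'
  have h1 : HasDerivAt (fun ρ : ℝ => hankelD1 (k * ρ)) (k * hankelD2 (k * ρ)) ρ := by
    have := (hasDerivAt_hankelD1 (mul_pos hk hρ)).scomp ρ ((hasDerivAt_id ρ).const_mul k)
    simpa [Function.comp_def] using this
  have h2 : HasDerivAt (fun ρ : ℝ => (ρ : ℂ)) 1 ρ := (hasDerivAt_id ρ).ofReal_comp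
  convert! ((h1.const_mul (k : ℂ)).const_mul (Complex.I / 4)).div h2 hC using 1
  rw [greenSlopeDeriv]
  field_simp

/-! ### Decay of differences of the Green function far from the source. -/

section Bounds

variable {a b : ℝ}

theorem inv_sqrt_mul_le (ha : 0 < a) {k ρ X : ℝ} (hk : a ≤ k) (hX : 0 < X) (hρ : X ≤ ρ) :
    (Real.sqrt (k * ρ))⁻¹ ≤ (Real.sqrt a)⁻¹ * (Real.sqrt X)⁻¹ := by
  rw [← mul_inv, ← Real.sqrt_mul ha.le]
  have : 0 < Real.sqrt (a * X) := by positivity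
  gcongr
  nlinarith

theorem exists_radial_bounds (ha : 0 < a) : ∃ C, 0 ≤ C ∧ ∀ k ∈ Icc a b, ∀ X, 1 ≤ X → ∀ ρ, X ≤ ρ →
    k * ‖hankelD1 (k * ρ)‖ ≤ C * (Real.sqrt X)⁻¹ ∧
      ‖greenSlopeDeriv k ρ‖ ≤ C * (Real.sqrt X)⁻¹ * X⁻¹ := by
  obtain ⟨C₁, hC₁, h₁⟩ := exists_hankelD1_bound
  obtain ⟨C₂, hC₂, h₂⟩ := exists_hankelD2_bound ha
  set A := |b| * (C₁ * (1 + 1 / a) * (Real.sqrt a)⁻¹) with hA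
  set B := b ^ 2 * (C₂ * (Real.sqrt a)⁻¹) with hB
  refine ⟨A + B, by positivity, fun k hk X hX ρ hρ => ?_⟩
  have hk0 : 0 < k := ha.trans_le hk.1
  have hX0 : 0 < X := by linarith
  have hρ0 : 0 < ρ := by linarith
  have hkb : k ≤ |b| := hk.2.trans (le_abs_self b)
  have hk2 : k ^ 2 ≤ b ^ 2 := by rw [← sq_abs b]; gcongr
  have hkρ : a ≤ k * ρ := by nlinarith [hk.1]
  have hs := inv_sqrt_mul_le ha hk.1 hX0 hρ
  have e1 : k * ‖hankelD1 (k * ρ)‖ ≤ A * (Real.sqrt X)⁻¹ := by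
    calc k * ‖hankelD1 (k * ρ)‖
        ≤ |b| * (C₁ * (1 + 1 / a) * ((Real.sqrt a)⁻¹ * (Real.sqrt X)⁻¹)) := by
          gcongr
          refine (h₁ _ (by positivity)).trans ?_
          gcongr
      _ = _ := by rw [hA]; ring
  have e2 : k ^ 2 * ‖hankelD2 (k * ρ)‖ ≤ B * (Real.sqrt X)⁻¹ := by
    calc k ^ 2 * ‖hankelD2 (k * ρ)‖ ≤ b ^ 2 * (C₂ * ((Real.sqrt a)⁻¹ * (Real.sqrt X)⁻¹)) := by
          gcongr
          refine (h₂ _ hkρ).trans ?_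
          gcongr
      _ = _ := by rw [hB]; ring
  constructor
  · refine e1.trans ?_
    gcongr
    exact le_add_of_nonneg_right (by positivity)
  · have e3 : ‖greenSlopeDeriv k ρ‖ ≤
        1 / 4 * (k ^ 2 * ‖hankelD2 (k * ρ)‖ / ρ + k * ‖hankelD1 (k * ρ)‖ / ρ ^ 2) := by
      rw [greenSlopeDeriv, norm_mul, norm_div, Complex.norm_I, Complex.norm_ofNat]
      gcongr
      refine (norm_sub_le _ _).trans (le_of_eq ?_)
      simp only [norm_mul, norm_div, norm_pow, Complex.norm_real, Real.norm_of_nonneg hk0.le,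
        Real.norm_of_nonneg hρ0.le]
    have e4 : k * ‖hankelD1 (k * ρ)‖ / ρ ^ 2 ≤ A * (Real.sqrt X)⁻¹ / X := by
      have : X ≤ ρ ^ 2 := by nlinarith
      gcongr
    have e5 : k ^ 2 * ‖hankelD2 (k * ρ)‖ / ρ ≤ B * (Real.sqrt X)⁻¹ / X := by gcongr
    have e6 : 0 ≤ B * (Real.sqrt X)⁻¹ / X + A * (Real.sqrt X)⁻¹ / X := by positivity
    calc _ ≤ _ := e3
      _ ≤ B * (Real.sqrt X)⁻¹ / X + A * (Real.sqrt X)⁻¹ / X := by linarith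
      _ = _ := by ring

/-- Differences of the free-space Green function and of its gradient at two distant points with
nearly the same norm. -/
theorem exists_green_sub_bound (ha : 0 < a) : ∃ C, 0 ≤ C ∧ ∀ k ∈ Icc a b, ∀ X, 1 ≤ X →
    ∀ r r' : Plane, X ≤ ‖r‖ → X ≤ ‖r'‖ →
      ‖freeGreen k r - freeGreen k r'‖ ≤
        C * (Real.sqrt X)⁻¹ * X⁻¹ * (|‖r‖ ^ 2 - ‖r'‖ ^ 2| + ‖r - r'‖) ∧
      ‖gradGreen k r - gradGreen k r'‖ ≤
        C * (Real.sqrt X)⁻¹ * X⁻¹ * (|‖r‖ ^ 2 - ‖r'‖ ^ 2| + ‖r - r'‖) := by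
  obtain ⟨C, hC0, hC⟩ := exists_radial_bounds (b := b) ha
  refine ⟨C, hC0, fun k hk X hX r r' hr hr' => ?_⟩
  have hk0 : 0 < k := ha.trans_le hk.1
  have hX0 : 0 < X := by linarith
  have hr0 : 0 < ‖r‖ := by linarith
  have hr0' : 0 < ‖r'‖ := by linarith
  have hsq : |‖r‖ ^ 2 - ‖r'‖ ^ 2| = |‖r‖ - ‖r'‖| * (‖r‖ + ‖r'‖) := by
    rw [sq_sub_sq, abs_mul, abs_of_pos (add_pos hr0 hr0'), mul_comm]
  have hdiff0 := abs_nonneg (‖r‖ - ‖r'‖)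
  -- Passing to squares exposes the gain: the difference of the norms is that of their squares
  -- divided by `‖r‖ + ‖r'‖ ≥ X`.
  have hd1 : |‖r‖ - ‖r'‖| ≤ X⁻¹ * |‖r‖ ^ 2 - ‖r'‖ ^ 2| := by
    rw [hsq, inv_mul_eq_div, le_div_iff₀ hX0]
    gcongr; linarith
  have hd2 : ‖r‖ * |‖r‖ - ‖r'‖| ≤ |‖r‖ ^ 2 - ‖r'‖ ^ 2| := by
    rw [hsq, mul_comm]
    gcongr; linarith
  have hw : 0 ≤ C * (Real.sqrt X)⁻¹ * X⁻¹ := by positivity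
  constructor
  · have hder : ∀ ρ ∈ Ici X, HasDerivWithinAt (fun ρ : ℝ => hankelH0 (k * ρ))
        (k * hankelD1 (k * ρ)) (Ici X) ρ := fun ρ hρ => by
      have := (hasDerivAt_hankelH0 (mul_pos hk0 (hX0.trans_le hρ))).scomp ρ
        ((hasDerivAt_id ρ).const_mul k)
      exact (by simpa [Function.comp_def] using this :
        HasDerivAt (fun ρ : ℝ => hankelH0 (k * ρ)) _ ρ).hasDerivWithinAt
    have h := (convex_Ici X).norm_image_sub_le_of_norm_hasDerivWithin_le hder
      (C := C * (Real.sqrt X)⁻¹) (fun ρ hρ => by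
        rw [norm_mul, Complex.norm_real, Real.norm_of_nonneg hk0.le]
        exact (hC k hk X hX ρ hρ).1) hr' hr
    rw [Real.norm_eq_abs] at h
    rw [freeGreen, freeGreen, ← mul_sub, norm_mul, norm_div, Complex.norm_I, Complex.norm_ofNat]
    calc _ ≤ 1 / 4 * (C * (Real.sqrt X)⁻¹ * (X⁻¹ * |‖r‖ ^ 2 - ‖r'‖ ^ 2|)) := by
          gcongr; exact h.trans (by gcongr)
      _ = 1 / 4 * (C * (Real.sqrt X)⁻¹ * X⁻¹ * |‖r‖ ^ 2 - ‖r'‖ ^ 2|) := by ring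
      _ ≤ C * (Real.sqrt X)⁻¹ * X⁻¹ * |‖r‖ ^ 2 - ‖r'‖ ^ 2| := by
          have : 0 ≤ C * (Real.sqrt X)⁻¹ * X⁻¹ * |‖r‖ ^ 2 - ‖r'‖ ^ 2| := by positivity
          linarith
      _ ≤ _ := by gcongr; exact le_add_of_nonneg_right (norm_nonneg _)
  · have h := (convex_Ici X).norm_image_sub_le_of_norm_hasDerivWithin_le
      (fun ρ hρ => (hasDerivAt_greenSlope hk0 (hX0.trans_le hρ)).hasDerivWithinAt)
      (C := C * (Real.sqrt X)⁻¹ * X⁻¹) (fun ρ hρ => (hC k hk X hX ρ hρ).2) hr' hr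
    rw [Real.norm_eq_abs] at h
    have hm : ‖greenSlope k ‖r'‖‖ ≤ C * (Real.sqrt X)⁻¹ * X⁻¹ := by
      rw [norm_greenSlope hk0 hr0']
      have h1 := (hC k hk X hX _ hr').1
      have h2 : 0 ≤ k * ‖hankelD1 (k * ‖r'‖)‖ := by positivity
      have h3 : 1 / 4 * (k * ‖hankelD1 (k * ‖r'‖)‖) ≤ C * (Real.sqrt X)⁻¹ := by linarith
      rw [← div_eq_mul_inv]
      gcongr
    -- The gradient is the position vector times a radial slope. The slope difference is multiplied
    -- by the large factor `‖r‖`, which `hd2` absorbs; in the other term the slope itself already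
    -- has the required decay.
    have hsplit : gradGreen k r - gradGreen k r' =
        (innerSL ℝ r).smulRight (greenSlope k ‖r‖ - greenSlope k ‖r'‖) +
          (innerSL ℝ (r - r')).smulRight (greenSlope k ‖r'‖) := by
      ext v
      simp [gradGreen_apply]
      ring
    rw [hsplit]
    refine (norm_add_le _ _).trans ?_
    rw [ContinuousLinearMap.norm_smulRight_apply, ContinuousLinearMap.norm_smulRight_apply,
      innerSL_apply_norm, innerSL_apply_norm]
    calc _ ≤ ‖r‖ * (C * (Real.sqrt X)⁻¹ * X⁻¹ * |‖r‖ - ‖r'‖|) +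
          ‖r - r'‖ * (C * (Real.sqrt X)⁻¹ * X⁻¹) := by gcongr
      _ = C * (Real.sqrt X)⁻¹ * X⁻¹ * (‖r‖ * |‖r‖ - ‖r'‖| + ‖r - r'‖) := by ring
      _ ≤ _ := by gcongr

end Bounds

/-! ### The lattice sum -/

/-- The gradient of `quasiGreenTerm`. -/
def quasiGradTerm (L θ h : ℝ) (j : ℕ) (k : ℝ) (r : Plane) (n : ℤ) : Plane →L[ℝ] ℂ :=
  Complex.exp (-Complex.I * (k * Real.sin θ * n * L : ℝ)) •
    ∑ l ∈ Finset.range (j + 1), ((-1 : ℂ) ^ l * (j.choose l : ℂ)) •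
      gradGreen k (r + ((n : ℝ) * L) • xHat + ((l : ℝ) * h) • yHat)

theorem norm_quasiPhase (L θ k : ℝ) (n : ℤ) :
    ‖Complex.exp (-Complex.I * (k * Real.sin θ * n * L : ℝ))‖ = 1 := by
  rw [show -Complex.I * ((k * Real.sin θ * n * L : ℝ) : ℂ) =
    ((-(k * Real.sin θ * n * L) : ℝ) : ℂ) * Complex.I by push_cast; ring]
  exact Complex.norm_exp_ofReal_mul_I _

theorem hasFDerivAt_quasiGreenTerm {L θ h k : ℝ} {j : ℕ} {r : Plane} {n : ℤ} (hk : 0 < k)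
    (hr : ∀ l ∈ Finset.range (j + 1), r + ((n : ℝ) * L) • xHat + ((l : ℝ) * h) • yHat ≠ 0) :
    HasFDerivAt (fun r => quasiGreenTerm L θ h j k r n) (quasiGradTerm L θ h j k r n) r := by
  simp only [quasiGreenTerm, shiftedGreen]
  refine HasFDerivAt.const_mul ?_ _
  refine HasFDerivAt.fun_sum fun l hl => HasFDerivAt.const_mul ?_ _
  have h1 : HasFDerivAt (fun r : Plane => r + ((n : ℝ) * L) • xHat + ((l : ℝ) * h) • yHat)
      (ContinuousLinearMap.id ℝ Plane) r := ((hasFDerivAt_id r).add_const _).add_const _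
  simpa using! (hasFDerivAt_freeGreen hk (hr l hl)).comp r h1

theorem continuousOn_shift_freeGreen {S : Set (ℝ × Plane)} (u w : Plane)
    (hS : ∀ q ∈ S, 0 < q.1 ∧ q.2 + u + w ≠ 0) :
    ContinuousOn (fun q : ℝ × Plane => freeGreen q.1 (q.2 + u + w)) S :=
  continuousOn_freeGreen.comp (f := fun q : ℝ × Plane => (q.1, q.2 + u + w)) (by fun_prop) hS

theorem continuousOn_shift_gradGreen {S : Set (ℝ × Plane)} (u w : Plane)
    (hS : ∀ q ∈ S, 0 < q.1 ∧ q.2 + u + w ≠ 0) :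
    ContinuousOn (fun q : ℝ × Plane => gradGreen q.1 (q.2 + u + w)) S :=
  continuousOn_gradGreen.comp (f := fun q : ℝ × Plane => (q.1, q.2 + u + w)) (by fun_prop) hS

theorem continuousOn_quasiGreenTerm {L θ h : ℝ} {j : ℕ} {n : ℤ} {S : Set (ℝ × Plane)}
    (hS : ∀ q ∈ S, 0 < q.1 ∧ ∀ l ∈ Finset.range (j + 1),
      q.2 + ((n : ℝ) * L) • xHat + ((l : ℝ) * h) • yHat ≠ 0) :
    ContinuousOn (fun q : ℝ × Plane => quasiGreenTerm L θ h j q.1 q.2 n) S := by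
  simp only [quasiGreenTerm, shiftedGreen]
  have hphase : ContinuousOn (fun q : ℝ × Plane =>
      Complex.exp (-Complex.I * (q.1 * Real.sin θ * n * L : ℝ))) S := by fun_prop
  refine hphase.mul (continuousOn_finsetSum _ fun l hl => ?_)
  exact continuousOn_const.mul
    (continuousOn_shift_freeGreen _ _ fun q hq => ⟨(hS q hq).1, (hS q hq).2 l hl⟩)

theorem continuousOn_quasiGradTerm {L θ h : ℝ} {j : ℕ} {n : ℤ} {S : Set (ℝ × Plane)}
    (hS : ∀ q ∈ S, 0 < q.1 ∧ ∀ l ∈ Finset.range (j + 1),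
      q.2 + ((n : ℝ) * L) • xHat + ((l : ℝ) * h) • yHat ≠ 0) :
    ContinuousOn (fun q : ℝ × Plane => quasiGradTerm L θ h j q.1 q.2 n) S := by
  have hphase : ContinuousOn (fun q : ℝ × Plane =>
      Complex.exp (-Complex.I * (q.1 * Real.sin θ * n * L : ℝ))) S := by fun_prop
  refine hphase.smul (continuousOn_finsetSum _ fun l hl => ?_)
  exact (continuousOn_shift_gradGreen _ _ fun q hq =>
    ⟨(hS q hq).1, (hS q hq).2 l hl⟩).const_smul ((-1 : ℂ) ^ l * (j.choose l : ℂ))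

/-- The coefficients sum to `(1 - 1)^j = 0`, so a common value may be subtracted from all shifts.
This cancellation is what makes the lattice sum converge absolutely. -/
theorem alternating_sum_smul {E : Type*} [AddCommGroup E] [Module ℂ E] {j : ℕ} (hj : 1 ≤ j)
    (f : ℕ → E) (c : E) :
    ∑ l ∈ Finset.range (j + 1), ((-1 : ℂ) ^ l * (j.choose l : ℂ)) • f l =
      ∑ l ∈ Finset.range (j + 1), ((-1 : ℂ) ^ l * (j.choose l : ℂ)) • (f l - c) := by
  have h1 : ∑ l ∈ Finset.range (j + 1), ((-1 : ℂ) ^ l * (j.choose l : ℂ)) = 0 := by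
    have := Int.alternating_sum_range_choose_of_ne (n := j) (by omega)
    exact_mod_cast congrArg (Int.cast : ℤ → ℂ) this
  simp only [smul_sub, Finset.sum_sub_distrib, ← Finset.sum_smul, h1, zero_smul, sub_zero]

theorem norm_alternating_sum_le {E : Type*} [SeminormedAddCommGroup E] [NormedSpace ℂ E] {j : ℕ}
    (f : ℕ → E) {B : ℝ} (hf : ∀ l ∈ Finset.range (j + 1), ‖f l‖ ≤ B) :
    ‖∑ l ∈ Finset.range (j + 1), ((-1 : ℂ) ^ l * (j.choose l : ℂ)) • f l‖ ≤ 2 ^ j * B := by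
  refine (norm_sum_le_of_le _ (f := fun l => ((-1 : ℂ) ^ l * (j.choose l : ℂ)) • f l)
    (n := fun l => (j.choose l : ℝ) * B) fun l hl => ?_).trans (le_of_eq ?_)
  · rw [norm_smul, norm_mul, norm_pow, norm_neg, norm_one, one_pow, one_mul, Complex.norm_natCast]
    gcongr
    exact hf l hl
  · rw [← Finset.sum_mul, ← Nat.cast_sum, Nat.sum_range_choose]
    push_cast; rfl

/-! ### Uniform summability and regularity of the lattice sum. -/

section Lattice

variable {L θ h a b M : ℝ} {j : ℕ}

theorem shift_coord_zero (z : Plane) (s t : ℝ) : (z + s • xHat + t • yHat) 0 = z 0 + s := by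
  simp [xHat, yHat]

theorem shift_coord_one (z : Plane) (s t : ℝ) : (z + s • xHat + t • yHat) 1 = z 1 + t := by
  simp [xHat, yHat]

theorem abs_coord_le (z : Plane) (i : Fin 2) : |z i| ≤ ‖z‖ := by
  simpa using PiLp.norm_apply_le z i

theorem le_norm_shift {z : Plane} (hz : ‖z‖ ≤ M) {n : ℤ} (hn : 2 * M + 2 ≤ |(n : ℝ)| * L)
    (hL : 0 < L) (t : ℝ) : |(n : ℝ)| * L / 2 ≤ ‖z + ((n : ℝ) * L) • xHat + t • yHat‖ := by
  refine le_trans ?_ (abs_coord_le _ 0)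
  rw [shift_coord_zero]
  have h1 := abs_coord_le z 0
  have h2 : |(n : ℝ) * L| = |(n : ℝ)| * L := by rw [abs_mul, abs_of_pos hL]
  have h3 := abs_sub_abs_le_abs_sub ((n : ℝ) * L) (-z 0)
  rw [abs_neg, sub_neg_eq_add, add_comm, h2] at h3
  have h4 : |(n : ℝ) * L + z 0| = |z 0 + n * L| := by rw [add_comm]
  linarith

/-- Summable bounds, uniform in the frequency, for the terms of the lattice sum and for their
gradients. -/
theorem exists_lattice_bound (hL : 0 < L) (hh : 0 < h) (hj : 1 ≤ j) (ha : 0 < a) (hM : 0 ≤ M) :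
    ∃ u : ℤ → ℝ, Summable u ∧ ∀ k ∈ Icc a b, ∀ z : Plane, ‖z‖ ≤ M → ∀ n : ℤ,
      2 * M + 2 ≤ |(n : ℝ)| * L →
        ‖quasiGreenTerm L θ h j k z n‖ ≤ u n ∧ ‖quasiGradTerm L θ h j k z n‖ ≤ u n := by
  obtain ⟨C, hC0, hC⟩ := exists_green_sub_bound (b := b) ha
  -- `Q` bounds the change of the squared norm plus the length of the shift. A vertical shift
  -- changes the squared norm by an amount that involves only the vertical coordinate, hence is
  -- independent of `n`.
  set Q := 2 * (j * h) * M + (j * h) ^ 2 + j * h with hQ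
  refine ⟨fun n => 2 ^ j * (C * (L / 2) ^ (-(3 / 2) : ℝ) * Q) * |(n : ℝ)| ^ (-(3 / 2) : ℝ),
    (Real.summable_abs_int_rpow (by norm_num)).mul_left _, fun k hk z hz n hn => ?_⟩
  set X := |(n : ℝ)| * L / 2 with hX
  -- The summand `2` in the threshold `2 M + 2` serves this inequality; the part `2 M` ensures that
  -- a point of norm at most `M` keeps distance `X` from the origin after translation.
  have hX1 : 1 ≤ X := by rw [hX]; linarith
  have hX0 : 0 < X := by linarith
  have hw : (Real.sqrt X)⁻¹ * X⁻¹ = (L / 2) ^ (-(3 / 2) : ℝ) * |(n : ℝ)| ^ (-(3 / 2) : ℝ) := by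
    rw [← Real.mul_rpow (by positivity) (abs_nonneg _), show L / 2 * |(n : ℝ)| = X by rw [hX]; ring,
      Real.sqrt_eq_rpow, ← Real.rpow_neg hX0.le, ← Real.rpow_neg_one X, ← Real.rpow_add hX0]
    norm_num
  have hlh : ∀ l ∈ Finset.range (j + 1), 0 ≤ (l : ℝ) * h ∧ (l : ℝ) * h ≤ j * h := fun l hl => by
    have : (l : ℝ) ≤ j := by exact_mod_cast Nat.lt_succ_iff.mp (Finset.mem_range.mp hl)
    exact ⟨by positivity, by gcongr⟩
  set r := z + ((n : ℝ) * L) • xHat with hr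
  have hr' : r + (0 : ℝ) • yHat = r := by simp
  have hnorm : ∀ t : ℝ, X ≤ ‖r + t • yHat‖ := le_norm_shift hz hn hL
  have hr1 : r 1 = z 1 := by
    have := shift_coord_one z ((n : ℝ) * L) 0
    simpa [hr] using this
  have hsq : ∀ l ∈ Finset.range (j + 1),
      |‖r + ((l : ℝ) * h) • yHat‖ ^ 2 - ‖r‖ ^ 2| + ‖r + ((l : ℝ) * h) • yHat - r‖ ≤ Q := by
    intro l hl
    obtain ⟨h0, h1⟩ := hlh l hl
    have e1 : ‖r + ((l : ℝ) * h) • yHat - r‖ = l * h := by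
      rw [add_sub_cancel_left, norm_smul, Real.norm_of_nonneg h0]
      simp [yHat, EuclideanSpace.norm_eq]
    have e2 : ‖r + ((l : ℝ) * h) • yHat‖ ^ 2 - ‖r‖ ^ 2 = 2 * (l * h) * z 1 + (l * h) ^ 2 := by
      rw [norm_sq_plane, norm_sq_plane, ← hr1]
      simp [yHat]; ring
    have e3 := abs_coord_le z 1
    rw [e1, e2]
    have e4 : |2 * ((l : ℝ) * h) * z 1 + (l * h) ^ 2| ≤ 2 * (j * h) * M + (j * h) ^ 2 := by
      refine (abs_add_le _ _).trans ?_
      rw [abs_mul, abs_of_nonneg (by positivity : 0 ≤ 2 * ((l : ℝ) * h)), abs_sq]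
      gcongr
      linarith
    linarith
  have hbound : ∀ l ∈ Finset.range (j + 1),
      C * (Real.sqrt X)⁻¹ * X⁻¹ *
        (|‖r + ((l : ℝ) * h) • yHat‖ ^ 2 - ‖r‖ ^ 2| + ‖r + ((l : ℝ) * h) • yHat - r‖) ≤
      C * (Real.sqrt X)⁻¹ * X⁻¹ * Q := fun l hl => by
    gcongr; exact hsq l hl
  have hfin : 2 ^ j * (C * (Real.sqrt X)⁻¹ * X⁻¹ * Q) =
      2 ^ j * (C * (L / 2) ^ (-(3 / 2) : ℝ) * Q) * |(n : ℝ)| ^ (-(3 / 2) : ℝ) := by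
    rw [mul_assoc C, hw]; ring
  have hrX : X ≤ ‖r‖ := by simpa [hr'] using hnorm 0
  beta_reduce
  constructor
  · rw [quasiGreenTerm, norm_mul, norm_quasiPhase, one_mul, shiftedGreen, ← hfin]
    have := alternating_sum_smul hj (fun l : ℕ => freeGreen k (r + ((l : ℝ) * h) • yHat))
      (freeGreen k r)
    simp only [smul_eq_mul] at this
    rw [this]
    exact norm_alternating_sum_le _ fun l hl =>
      (hC k hk X hX1 _ r (hnorm _) hrX).1.trans (hbound l hl)
  · rw [quasiGradTerm, norm_smul, norm_quasiPhase, one_mul, ← hfin,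
      alternating_sum_smul hj _ (gradGreen k r)]
    exact norm_alternating_sum_le _ fun l hl =>
      (hC k hk X hX1 _ r (hnorm _) hrX).2.trans (hbound l hl)

/-- A finite set of lattice indices that contains those of all nearby obstacles. -/
def nearIndices (L M : ℝ) : Finset ℤ :=
  Finset.Icc (-⌈(2 * M + 2) / L⌉) ⌈(2 * M + 2) / L⌉

theorem le_of_notMem_nearIndices (hL : 0 < L) {n : ℤ} (hn : n ∉ nearIndices L M) :
    2 * M + 2 ≤ |(n : ℝ)| * L := by
  rw [nearIndices, Finset.mem_Icc, ← abs_le, not_le] at hn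
  rw [← div_le_iff₀ hL]
  have h1 : (⌈(2 * M + 2) / L⌉ : ℝ) < |(n : ℝ)| := by exact_mod_cast hn
  exact (Int.le_ceil _).trans h1.le

/-- The part of the lattice sum that comes from the distant obstacles. -/
def farGreen (L θ h M : ℝ) (j : ℕ) (k : ℝ) (z : Plane) : ℂ :=
  ∑' n : {n // n ∉ nearIndices L M}, quasiGreenTerm L θ h j k z n

/-- The gradient of `farGreen`. -/
def farGrad (L θ h M : ℝ) (j : ℕ) (k : ℝ) (z : Plane) : Plane →L[ℝ] ℂ :=
  ∑' n : {n // n ∉ nearIndices L M}, quasiGradTerm L θ h j k z n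

theorem shift_ne_zero_of_far (hL : 0 < L) (hM : 0 ≤ M) {z : Plane} (hz : ‖z‖ ≤ M) {n : ℤ}
    (hn : n ∉ nearIndices L M) (t : ℝ) : z + ((n : ℝ) * L) • xHat + t • yHat ≠ 0 := by
  have h1 := le_of_notMem_nearIndices hL hn
  have h2 := le_norm_shift hz h1 hL t
  exact norm_pos_iff.mp (by linarith)

theorem summable_quasiGreenTerm (hL : 0 < L) (hh : 0 < h) (hj : 1 ≤ j) {k : ℝ} (hk : 0 < k)
    (z : Plane) : Summable (quasiGreenTerm L θ h j k z) := by
  obtain ⟨u, hu, hb⟩ := exists_lattice_bound (θ := θ) (b := k) hL hh hj hk (norm_nonneg z)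
  refine Summable.of_norm_bounded_eventually hu ?_
  filter_upwards [(nearIndices L ‖z‖).finite_toSet.compl_mem_cofinite] with n hn
  exact (hb k ⟨le_rfl, le_rfl⟩ z le_rfl n (le_of_notMem_nearIndices hL hn)).1

theorem quasiGreen_eq (hL : 0 < L) (hh : 0 < h) (hj : 1 ≤ j) {k : ℝ} (hk : 0 < k) (z : Plane) :
    quasiGreen L θ h j k z =
      (∑ n ∈ nearIndices L M, quasiGreenTerm L θ h j k z n) + farGreen L θ h M j k z :=
  ((summable_quasiGreenTerm hL hh hj hk z).sum_add_tsum_subtype_compl _).symm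

/-- Termwise differentiation: on the ball no distant term is singular, and the gradients have a
common summable majorant. -/
theorem hasFDerivAt_farGreen (hL : 0 < L) (hh : 0 < h) (hj : 1 ≤ j) (hM : 0 ≤ M) {k : ℝ}
    (hk : 0 < k) {z : Plane} (hz : z ∈ Metric.ball (0 : Plane) M) :
    HasFDerivAt (farGreen L θ h M j k) (farGrad L θ h M j k z) z := by
  obtain ⟨u, hu, hb⟩ := exists_lattice_bound (θ := θ) (b := k) hL hh hj hk hM
  have hball : ∀ z ∈ Metric.ball (0 : Plane) M, ‖z‖ ≤ M := fun z hz =>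
    (mem_ball_zero_iff.mp hz).le
  exact hasFDerivAt_tsum_of_isPreconnected (hu.subtype {n | n ∉ nearIndices L M})
    Metric.isOpen_ball (convex_ball _ _).isPreconnected
    (f := fun (n : {n // n ∉ nearIndices L M}) z => quasiGreenTerm L θ h j k z n)
    (f' := fun (n : {n // n ∉ nearIndices L M}) z => quasiGradTerm L θ h j k z n)
    (fun n z hz => hasFDerivAt_quasiGreenTerm hk fun l _ =>
      shift_ne_zero_of_far hL hM (hball z hz) n.2 _)
    (fun n z hz => (hb k ⟨le_rfl, le_rfl⟩ z (hball z hz) n (le_of_notMem_nearIndices hL n.2)).2)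
    hz ((summable_quasiGreenTerm hL hh hj hk z).subtype _) hz

theorem hasFDerivAt_quasiGreen (hL : 0 < L) (hh : 0 < h) (hj : 1 ≤ j) (hM : 0 ≤ M) {k : ℝ}
    (hk : 0 < k) {z : Plane} (hz : z ∈ Metric.ball (0 : Plane) M)
    (hne : ∀ n : ℤ, ∀ l ∈ Finset.range (j + 1),
      z + ((n : ℝ) * L) • xHat + ((l : ℝ) * h) • yHat ≠ 0) :
    HasFDerivAt (quasiGreen L θ h j k)
      ((∑ n ∈ nearIndices L M, quasiGradTerm L θ h j k z n) + farGrad L θ h M j k z) z := by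
  rw [show quasiGreen L θ h j k = fun z => (∑ n ∈ nearIndices L M, quasiGreenTerm L θ h j k z n) +
    farGreen L θ h M j k z from funext fun z => quasiGreen_eq hL hh hj hk z]
  exact (HasFDerivAt.fun_sum fun n _ => hasFDerivAt_quasiGreenTerm hk (hne n)).add
    (hasFDerivAt_farGreen hL hh hj hM hk hz)

theorem continuousOn_farGreen (hL : 0 < L) (hh : 0 < h) (hj : 1 ≤ j) (hM : 0 ≤ M) (ha : 0 < a) :
    ContinuousOn (fun q : ℝ × Plane => farGreen L θ h M j q.1 q.2)
      (Icc a b ×ˢ Metric.ball 0 M) := by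
  obtain ⟨u, hu, hb⟩ := exists_lattice_bound (θ := θ) (b := b) hL hh hj ha hM
  refine continuousOn_tsum (fun n => ?_) (hu.subtype {n | n ∉ nearIndices L M}) fun n q hq =>
    (hb q.1 hq.1 q.2 (mem_ball_zero_iff.mp hq.2).le n (le_of_notMem_nearIndices hL n.2)).1
  exact continuousOn_quasiGreenTerm fun q hq => ⟨ha.trans_le hq.1.1, fun l _ =>
    shift_ne_zero_of_far hL hM (mem_ball_zero_iff.mp hq.2).le n.2 _⟩

theorem continuousOn_farGrad (hL : 0 < L) (hh : 0 < h) (hj : 1 ≤ j) (hM : 0 ≤ M) (ha : 0 < a) :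
    ContinuousOn (fun q : ℝ × Plane => farGrad L θ h M j q.1 q.2)
      (Icc a b ×ˢ Metric.ball 0 M) := by
  obtain ⟨u, hu, hb⟩ := exists_lattice_bound (θ := θ) (b := b) hL hh hj ha hM
  refine continuousOn_tsum (fun n => ?_) (hu.subtype {n | n ∉ nearIndices L M}) fun n q hq =>
    (hb q.1 hq.1 q.2 (mem_ball_zero_iff.mp hq.2).le n (le_of_notMem_nearIndices hL n.2)).2
  exact continuousOn_quasiGradTerm fun q hq => ⟨ha.trans_le hq.1.1, fun l _ =>
    shift_ne_zero_of_far hL hM (mem_ball_zero_iff.mp hq.2).le n.2 _⟩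

end Lattice

/-! ### The kernel of the layer potential -/

section Layer

variable {D : Set Plane} {L θ h γ a b M : ℝ} {j : ℕ}

/-- The combined-field kernel of the free-space Green function with shifted argument. -/
def shiftKernel (D : Set Plane) (γ : ℝ) (u w : Plane) (k : ℝ) (x y : frontier D) : ℂ :=
  -gradGreen k ((x : Plane) - y + u + w) (normal D y) -
    Complex.I * γ * freeGreen k ((x : Plane) - y + u + w)

theorem continuousOn_shiftKernel (hD : HasC2Boundary D) (u w : Plane)
    {T : Set (ℝ × frontier D × frontier D)}
    (hT : ∀ q ∈ T, 0 < q.1 ∧ (q.2.1 : Plane) - q.2.2 + u + w ≠ 0) :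
    ContinuousOn (fun q : ℝ × frontier D × frontier D => shiftKernel D γ u w q.1 q.2.1 q.2.2) T := by
  have hmap : ContinuousOn (fun q : ℝ × frontier D × frontier D =>
      ((q.1, (q.2.1 : Plane) - q.2.2 + u + w) : ℝ × Plane)) T := by fun_prop
  have h1 := continuousOn_gradGreen.comp hmap hT
  have h2 := continuousOn_freeGreen.comp hmap hT
  have h3 : Continuous fun q : ℝ × frontier D × frontier D => normal D q.2.2 :=
    hD.continuous_normal.comp (by fun_prop)
  exact (h1.clm_apply h3.continuousOn).neg.sub (continuousOn_const.mul h2)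

/-- With `z = x - y`, the double-layer part is `⟨ν, z⟩` times the radial slope. The slope is
`O(|z|^(-5/2))` near the diagonal and the inner product is `O(|z|²)`, so the order is `1/2`; the
single-layer part has this order by the bound for `H₀`. -/
theorem exists_singular_bound (hD : HasC2Boundary D) (hc : IsCompact (frontier D)) (ha : 0 < a) :
    ∃ C : ℝ, ∀ k ∈ Icc a b, ∀ x y : frontier D, x ≠ y →
      ‖shiftKernel D γ 0 0 k x y‖ ≤ C * (Real.sqrt (dist x y))⁻¹ := by
  obtain ⟨C₀, hC₀, h₀⟩ := exists_hankelH0_bound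
  obtain ⟨C₁, hC₁, h₁⟩ := exists_hankelD1_bound
  obtain ⟨C, hC⟩ := hD.exists_inner_le hc
  set d := Metric.diam (frontier D)
  have hd0 : 0 ≤ d := Metric.diam_nonneg
  refine ⟨|C| * (1 / 4 * (C₁ * (|b| * d + 1)) * (Real.sqrt a)⁻¹) +
    |γ| * (1 / 4 * (C₀ * (Real.sqrt a)⁻¹)), fun k hk x y hxy => ?_⟩
  set z : Plane := (x : Plane) - y with hz
  have hk0 : 0 < k := ha.trans_le hk.1
  have hdist : dist x y = ‖z‖ := by rw [Subtype.dist_eq, dist_eq_norm]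
  have hz0 : 0 < ‖z‖ := by rw [← hdist]; exact dist_pos.mpr hxy
  have hzd : ‖z‖ ≤ d := by
    rw [← hdist]; exact Metric.dist_le_diam_of_mem hc.isBounded x.2 y.2
  have hkb : k ≤ |b| := hk.2.trans (le_abs_self b)
  have hs := inv_sqrt_mul_le ha hk.1 hz0 le_rfl
  have hkz : 0 < k * ‖z‖ := by positivity
  have e1 : ‖gradGreen k z (normal D y)‖ ≤
      |C| * (1 / 4 * (C₁ * (|b| * d + 1)) * (Real.sqrt a)⁻¹) * (Real.sqrt ‖z‖)⁻¹ := by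
    rw [gradGreen_apply, norm_mul, Complex.norm_real, Real.norm_eq_abs, real_inner_comm,
      norm_greenSlope hk0 hz0]
    have i1 : |inner ℝ (normal D y) z| ≤ |C| * ‖z‖ ^ 2 :=
      (hC x x.2 y y.2).trans (by gcongr; exact le_abs_self C)
    have i2 : ‖hankelD1 (k * ‖z‖)‖ ≤
        C₁ * (1 + 1 / (k * ‖z‖)) * ((Real.sqrt a)⁻¹ * (Real.sqrt ‖z‖)⁻¹) :=
      (h₁ _ hkz).trans (by gcongr)
    calc _ ≤ |C| * ‖z‖ ^ 2 * (1 / 4 * (k * (C₁ * (1 + 1 / (k * ‖z‖)) *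
            ((Real.sqrt a)⁻¹ * (Real.sqrt ‖z‖)⁻¹))) / ‖z‖) := by gcongr
      _ = |C| * (1 / 4 * (C₁ * (k * ‖z‖ + 1)) * (Real.sqrt a)⁻¹) * (Real.sqrt ‖z‖)⁻¹ := by
          field_simp
      _ ≤ _ := by gcongr
  have e2 : ‖freeGreen k z‖ ≤ 1 / 4 * (C₀ * (Real.sqrt a)⁻¹) * (Real.sqrt ‖z‖)⁻¹ := by
    rw [norm_freeGreen]
    calc _ ≤ 1 / 4 * (C₀ * ((Real.sqrt a)⁻¹ * (Real.sqrt ‖z‖)⁻¹)) := by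
          gcongr; exact (h₀ _ hkz).trans (by gcongr)
      _ = _ := by ring
  rw [shiftKernel, add_zero, add_zero, hdist, add_mul]
  refine (norm_sub_le _ _).trans (add_le_add ?_ ?_)
  · rw [norm_neg]; exact e1
  · rw [norm_mul, norm_mul, Complex.norm_I, one_mul, Complex.norm_real, Real.norm_eq_abs, mul_assoc]
    gcongr

/-- Only the unshifted kernel meets the singularity of the Green function; when the shift keeps all
differences off the origin, the kernel is continuous up to the diagonal. -/
theorem weaklySingular_shiftKernel (hD : HasC2Boundary D) (hc : IsCompact (frontier D))
    (ha : 0 < a) (u w : Plane)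
    (huw : (u = 0 ∧ w = 0) ∨ ∀ x y : frontier D, (x : Plane) - y + u + w ≠ 0) :
    WeaklySingular (Icc a b) (shiftKernel D γ u w) := by
  have : CompactSpace (frontier D) := isCompact_iff_compactSpace.mp hc
  rcases huw with ⟨rfl, rfl⟩ | huw
  · refine ⟨continuousOn_shiftKernel hD 0 0 fun q hq => ⟨ha.trans_le hq.1.1, ?_⟩,
      exists_singular_bound hD hc ha⟩
    rw [add_zero, add_zero]
    exact sub_ne_zero.mpr fun h => hq.2 (Subtype.ext h)
  · exact .of_continuousOn isCompact_Icc
      (continuousOn_shiftKernel hD u w fun q hq => ⟨ha.trans_le hq.1.1, huw _ _⟩)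

/-- The kernel of the distant obstacles. -/
def farKernel (D : Set Plane) (L θ h γ M : ℝ) (j : ℕ) (k : ℝ) (x y : frontier D) : ℂ :=
  -farGrad L θ h M j k ((x : Plane) - y) (normal D y) -
    Complex.I * γ * farGreen L θ h M j k ((x : Plane) - y)

theorem weaklySingular_farKernel (hD : HasC2Boundary D) (hc : IsCompact (frontier D))
    (hL : 0 < L) (hh : 0 < h) (hj : 1 ≤ j) (hM : 0 ≤ M) (ha : 0 < a)
    (hdM : ∀ x y : frontier D, (x : Plane) - y ∈ Metric.ball (0 : Plane) M) :
    WeaklySingular (Icc a b) (farKernel D L θ h γ M j) := by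
  have : CompactSpace (frontier D) := isCompact_iff_compactSpace.mp hc
  refine .of_continuousOn isCompact_Icc ?_
  have hmap : ContinuousOn (fun q : ℝ × frontier D × frontier D =>
      ((q.1, (q.2.1 : Plane) - q.2.2) : ℝ × Plane)) (Icc a b ×ˢ univ) := by fun_prop
  have hmaps : MapsTo (fun q : ℝ × frontier D × frontier D =>
      ((q.1, (q.2.1 : Plane) - q.2.2) : ℝ × Plane)) (Icc a b ×ˢ univ)
      (Icc a b ×ˢ Metric.ball 0 M) := fun q hq => ⟨hq.1, hdM _ _⟩
  have h1 := (continuousOn_farGrad (θ := θ) (b := b) hL hh hj hM ha).comp hmap hmaps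
  have h2 := (continuousOn_farGreen (θ := θ) (b := b) hL hh hj hM ha).comp hmap hmaps
  have h3 : Continuous fun q : ℝ × frontier D × frontier D => normal D q.2.2 :=
    hD.continuous_normal.comp (by fun_prop)
  exact (h1.clm_apply h3.continuousOn).neg.sub (continuousOn_const.mul h2)

/-- The derivative is taken in the second point of `x - y`, hence the minus sign in front of the
gradient. -/
theorem combined_comp_sub {G : Plane → ℂ} {G' : Plane →L[ℝ] ℂ} {x y : Plane}
    (hG : HasFDerivAt G G' (x - y)) :
    combined D γ (fun s => G (x - s)) y = -G' (normal D y) - Complex.I * γ * G (x - y) := by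
  have h1 : HasFDerivAt (fun s : Plane => x - s) (-ContinuousLinearMap.id ℝ Plane) y :=
    (hasFDerivAt_id y).const_sub x
  have h2 : HasFDerivAt (fun s => G (x - s)) (G'.comp (-ContinuousLinearMap.id ℝ Plane)) y :=
    hG.comp y h1
  rw [combined, h2.fderiv]
  simp

theorem combined_quasiGreen (hL : 0 < L) (hh : 0 < h) (hj : 1 ≤ j) (hM : 0 ≤ M) {k : ℝ}
    (hk : 0 < k) {x y : frontier D} (hxy : (x : Plane) - y ∈ Metric.ball (0 : Plane) M)
    (hne : ∀ n : ℤ, ∀ l ∈ Finset.range (j + 1),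
      (x : Plane) - y + ((n : ℝ) * L) • xHat + ((l : ℝ) * h) • yHat ≠ 0) :
    combined D γ (fun s => quasiGreen L θ h j k ((x : Plane) - s)) y =
      (∑ n ∈ nearIndices L M, Complex.exp (-Complex.I * (k * Real.sin θ * n * L : ℝ)) *
        ∑ l ∈ Finset.range (j + 1), (-1 : ℂ) ^ l * (j.choose l : ℂ) *
          shiftKernel D γ (((n : ℝ) * L) • xHat) (((l : ℝ) * h) • yHat) k x y) +
        farKernel D L θ h γ M j k x y := by
  rw [combined_comp_sub (hasFDerivAt_quasiGreen hL hh hj hM hk hxy hne),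
    quasiGreen_eq (M := M) hL hh hj hk]
  simp only [shiftKernel, farKernel, quasiGreenTerm, shiftedGreen, quasiGradTerm,
    add_apply, sum_apply, smul_apply,
    smul_eq_mul, mul_sub, mul_neg, Finset.sum_sub_distrib, Finset.sum_neg_distrib, mul_add,
    Finset.mul_sum, neg_add]
  have e : ∀ (p c g : ℂ) (l : ℕ), Complex.I * γ * (p * ((-1) ^ l * c * g)) =
      p * ((-1) ^ l * c * (Complex.I * γ * g)) := fun p c g l => by ring
  simp only [e]
  ring

theorem weaklySingular_layer (hD : HasC2Boundary D) (hc : IsCompact (frontier D))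
    (hL : 0 < L) (hh : 0 < h) (hj : 1 ≤ j) (ha : 0 < a)
    (hlat : ∀ x ∈ frontier D, ∀ y ∈ frontier D, ∀ (n : ℤ) (l : ℕ),
      x - y + ((n : ℝ) * L) • xHat + ((l : ℝ) * h) • yHat = 0 → n = 0 ∧ l = 0) :
    WeaklySingular (Icc a b) fun k (x y : frontier D) =>
      combined D γ (fun s => quasiGreen L θ h j k ((x : Plane) - s)) y := by
  -- The added one puts all differences of boundary points into an open ball, where the tail can be
  -- differentiated.
  set M := Metric.diam (frontier D) + 1 with hMdef
  have hM : 0 ≤ M := by positivity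
  have hdM : ∀ x y : frontier D, (x : Plane) - y ∈ Metric.ball (0 : Plane) M := fun x y => by
    rw [mem_ball_zero_iff, ← dist_eq_norm]
    have := Metric.dist_le_diam_of_mem hc.isBounded x.2 y.2
    linarith
  refine WeaklySingular.congr (K := fun k x y =>
    (∑ n ∈ nearIndices L M, Complex.exp (-Complex.I * (k * Real.sin θ * n * L : ℝ)) *
        ∑ l ∈ Finset.range (j + 1), (-1 : ℂ) ^ l * (j.choose l : ℂ) *
          shiftKernel D γ (((n : ℝ) * L) • xHat) (((l : ℝ) * h) • yHat) k x y) +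
        farKernel D L θ h γ M j k x y) ?_ fun k hk x y hxy => ?_
  · refine .add (.sum _ fun n _ => .mul_left (.sum _ fun l _ => .mul_left ?_ isCompact_Icc
      continuousOn_const) isCompact_Icc (Continuous.continuousOn (by fun_prop)))
      (weaklySingular_farKernel hD hc hL hh hj hM ha hdM)
    refine weaklySingular_shiftKernel hD hc ha _ _ ?_
    by_cases h0 : n = 0 ∧ l = 0
    · left; simp [h0.1, h0.2]
    · exact Or.inr fun x y h1 => h0 (hlat x x.2 y y.2 n l h1)
  · refine combined_quasiGreen hL hh hj hM (ha.trans_le hk.1) (hdM x y) fun n l _ h1 => hxy ?_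
    obtain ⟨rfl, rfl⟩ := hlat x x.2 y y.2 n l h1
    refine Subtype.ext (sub_eq_zero.mp ?_)
    simpa using h1

theorem differentiableAt_quasiGreen (hL : 0 < L) (hh : 0 < h) (hj : 1 ≤ j) {k : ℝ} (hk : 0 < k)
    {z : Plane} (hne : ∀ n : ℤ, ∀ l ∈ Finset.range (j + 1),
      z + ((n : ℝ) * L) • xHat + ((l : ℝ) * h) • yHat ≠ 0) :
    DifferentiableAt ℝ (quasiGreen L θ h j k) z :=
  (hasFDerivAt_quasiGreen (M := ‖z‖ + 1) hL hh hj (by positivity) hk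
    (mem_ball_zero_iff.mpr (lt_add_one _)) hne).differentiableAt

/-- The singularities of the shifted lattice sum are avoided by the differences of boundary
points. -/
theorem lattice_point_eq_zero (hDc : IsClosed D) (hh : 0 < h)
    (hdisj : Pairwise fun m n : ℤ => Disjoint (obstacle D L m) (obstacle D L n))
    (hshift : ∀ r ∈ frontier D, ∀ r' ∈ frontier D, |r 1 - r' 1| < h) :
    ∀ x ∈ frontier D, ∀ y ∈ frontier D, ∀ (n : ℤ) (l : ℕ),
      x - y + ((n : ℝ) * L) • xHat + ((l : ℝ) * h) • yHat = 0 → n = 0 ∧ l = 0 := by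
  intro x hx y hy n l h0
  have hl : l = 0 := by
    by_contra hl
    have h1 : (1 : ℝ) ≤ l := by exact_mod_cast Nat.one_le_iff_ne_zero.mpr hl
    have h2 := shift_coord_one (x - y) ((n : ℝ) * L) ((l : ℝ) * h)
    rw [h0] at h2
    simp only [PiLp.zero_apply, PiLp.sub_apply] at h2
    have h3 := neg_abs_le (x 1 - y 1)
    have h4 := hshift x hx y hy
    -- A vertical shift by `l h ≥ h` cannot be compensated by a difference of boundary heights.
    nlinarith
  subst hl
  refine ⟨?_, rfl⟩
  by_contra hn
  -- The obstacles with indices `n` and `0` would share the point `y`.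
  have h1 : x + ((n : ℝ) * L) • xHat = y := by
    rw [← sub_eq_zero, ← h0]
    simp
    abel
  refine disjoint_left.mp (hdisj hn) ⟨x, hDc.frontier_subset hx, rfl⟩
    ⟨y, hDc.frontier_subset hy, ?_⟩
  simp [h1]

end Layer

/-! ### The Rayleigh series -/

/-- `Real.sqrt` vanishes on negative arguments, so one formula covers both branches and shows
continuity in `k`, also across a zero of `β_n`. -/
theorem beta_eq (L θ k : ℝ) (n : ℤ) :
    beta L θ k n = (Real.sqrt (k ^ 2 - alpha L θ k n ^ 2) : ℂ) +
      Complex.I * (Real.sqrt (alpha L θ k n ^ 2 - k ^ 2) : ℂ) := by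
  rw [beta]
  split_ifs with h
  · rw [Real.sqrt_eq_zero_of_nonpos (x := alpha L θ k n ^ 2 - k ^ 2) (by linarith)]
    simp
  · rw [Real.sqrt_eq_zero_of_nonpos (x := k ^ 2 - alpha L θ k n ^ 2) (by linarith)]
    simp

theorem continuous_alpha (L θ : ℝ) (n : ℤ) : Continuous fun k => alpha L θ k n := by
  unfold alpha; fun_prop

theorem continuous_beta (L θ : ℝ) (n : ℤ) : Continuous fun k => beta L θ k n := by
  have := continuous_alpha L θ n
  simp only [beta_eq]
  fun_prop

theorem continuous_sigma (L θ h : ℝ) (j : ℕ) (n : ℤ) : Continuous fun k => sigma L θ h j k n := by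
  have := continuous_beta L θ n
  unfold sigma
  fun_prop

theorem continuous_planeWave (L θ : ℝ) (n : ℤ) :
    Continuous fun q : ℝ × Plane => planeWave L θ q.1 n q.2 := by
  have h1 : Continuous fun q : ℝ × Plane => alpha L θ q.1 n :=
    (continuous_alpha L θ n).comp continuous_fst
  have h2 : Continuous fun q : ℝ × Plane => beta L θ q.1 n :=
    (continuous_beta L θ n).comp continuous_fst
  unfold planeWave
  fun_prop

/-- The decay rate in the vertical direction of an evanescent mode. -/
def decayRate (L θ k : ℝ) (n : ℤ) : ℝ := Real.sqrt (alpha L θ k n ^ 2 - k ^ 2)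

/-! ### Estimates for evanescent modes. -/

section Evanescent

variable {L θ k b : ℝ} {n : ℤ}

theorem abs_alpha_le (hL : 0 < L) (hk : 0 ≤ k) :
    |alpha L θ k n| ≤ 2 * Real.pi / L * |(n : ℝ)| + k := by
  have hw : 0 < 2 * Real.pi / L := by positivity
  rw [alpha]
  refine (abs_add_le _ _).trans ?_
  rw [abs_mul, abs_mul, abs_of_pos hw, abs_of_nonneg hk, add_comm]
  gcongr
  exact mul_le_of_le_one_right hk (Real.abs_sin_le_one θ)

theorem le_abs_alpha (hL : 0 < L) (hk : 0 ≤ k) :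
    2 * Real.pi / L * |(n : ℝ)| - k ≤ |alpha L θ k n| := by
  have hw : 0 < 2 * Real.pi / L := by positivity
  have h1 : |2 * Real.pi / L * (n : ℝ)| = 2 * Real.pi / L * |(n : ℝ)| := by
    rw [abs_mul, abs_of_pos hw]
  have h2 : |k * Real.sin θ| ≤ k := by
    rw [abs_mul, abs_of_nonneg hk]
    exact mul_le_of_le_one_right hk (Real.abs_sin_le_one θ)
  have h3 := abs_sub_abs_le_abs_sub (2 * Real.pi / L * (n : ℝ)) (-(k * Real.sin θ))
  rw [abs_neg, sub_neg_eq_add, add_comm (2 * Real.pi / L * (n : ℝ)), h1] at h3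
  rw [alpha]
  linarith

/-- With `W = 2 π |n| / L ≥ 3 k`, one has `α_n² - k² ≥ (W - k)² - k² = W (W - 2 k) ≥ W² / 3`, more
than the required `W² / 4`. -/
theorem le_decayRate (hL : 0 < L) (hk : 0 ≤ k) (hn : 3 * k ≤ 2 * Real.pi / L * |(n : ℝ)|) :
    2 * Real.pi / L * |(n : ℝ)| / 2 ≤ decayRate L θ k n := by
  have h1 := le_abs_alpha (θ := θ) (n := n) hL hk
  apply Real.le_sqrt_of_sq_le
  rw [← sq_abs (alpha L θ k n)]
  nlinarith

theorem beta_of_decayRate_pos (h : 0 < decayRate L θ k n) :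
    beta L θ k n = Complex.I * decayRate L θ k n := by
  have h1 := Real.sqrt_pos.mp h
  rw [beta, if_neg (by linarith), decayRate]

theorem decayRate_le : decayRate L θ k n ≤ |alpha L θ k n| := by
  rw [decayRate, ← Real.sqrt_sq_eq_abs]
  exact Real.sqrt_le_sqrt (by nlinarith [sq_nonneg k])

/-- For an evanescent mode `exp(i β h)` is a real number `q` in `(0, 1)`, and Bernoulli's inequality
gives `1 - j q ≤ (1 - q)^j ≤ 1`. -/
theorem norm_sigma_le {h : ℝ} (hh : 0 < h) (j : ℕ) (hs : 0 < decayRate L θ k n) :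
    ‖sigma L θ h j k n‖ ≤ j * Real.exp (-(decayRate L θ k n * h)) := by
  set q := Real.exp (-(decayRate L θ k n * h)) with hq
  have hq0 : 0 < q := Real.exp_pos _
  have hq1 : q ≤ 1 := Real.exp_le_one_iff.mpr (by nlinarith)
  have h1 : sigma L θ h j k n = (((1 - q) ^ j - 1 : ℝ) : ℂ) := by
    rw [sigma, beta_of_decayRate_pos hs, hq]
    push_cast
    congr 3
    rw [← mul_assoc, Complex.I_mul_I]
    ring_nf
  rw [h1, Complex.norm_real, Real.norm_eq_abs, abs_le]
  have h2 := one_add_mul_le_pow (a := -q) (by linarith) j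
  have h3 : (1 - q) ^ j ≤ 1 := pow_le_one₀ (by linarith) (by linarith)
  rw [← sub_eq_add_neg] at h2
  constructor
  · linarith
  · have : 0 ≤ j * q := by positivity
    linarith

theorem norm_planeWave (hs : 0 < decayRate L θ k n) (r : Plane) :
    ‖planeWave L θ k n r‖ = Real.exp (-(decayRate L θ k n * r 1)) := by
  rw [planeWave, Complex.norm_exp, beta_of_decayRate_pos hs]
  congr 1
  rw [show Complex.I * alpha L θ k n * r 0 + Complex.I * (Complex.I * decayRate L θ k n) * r 1 =
    ((-(decayRate L θ k n * r 1) : ℝ) : ℂ) + ((alpha L θ k n * r 0 : ℝ) : ℂ) * Complex.I by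
      push_cast
      rw [← mul_assoc Complex.I Complex.I, Complex.I_mul_I]; ring]
  simp

end Evanescent

/-- Uniformity in the infinitely many `n`: for `k < 2 k₀` all modes outside a finite range are
evanescent with a positive decay rate, and the finitely many others are treated by continuity at
`k₀`. -/
theorem eventually_beta_ne_zero {L : ℝ} (hL : 0 < L) (θ : ℝ) {k₀ : ℝ} (hk₀ : 0 < k₀) :
    ∀ᶠ k in 𝓝 k₀, ∀ n ∉ woodModes L θ k₀, beta L θ k n ≠ 0 := by
  have hw : 0 < 2 * Real.pi / L := by positivity
  set N := ⌈3 * (2 * k₀) / (2 * Real.pi / L)⌉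
  have h1 : ∀ᶠ k in 𝓝 k₀, ∀ n ∈ Finset.Icc (-N) N, n ∉ woodModes L θ k₀ → beta L θ k n ≠ 0 := by
    rw [eventually_all_finset]
    intro n _
    by_cases hn : n ∈ woodModes L θ k₀
    · exact Eventually.of_forall fun k h => absurd hn h
    · filter_upwards [(continuous_beta L θ n).continuousAt.eventually_ne
        (show beta L θ k₀ n ≠ 0 from hn)] with k hk _ using hk
  filter_upwards [h1, Ioo_mem_nhds hk₀ (show k₀ < 2 * k₀ by linarith)] with k hk hk2 n hn
  by_cases hN : n ∈ Finset.Icc (-N) N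
  · exact hk n hN hn
  · rw [Finset.mem_Icc, ← abs_le, not_le] at hN
    have h2 : (N : ℝ) < |(n : ℝ)| := by exact_mod_cast hN
    have h3 := (Int.le_ceil _).trans h2.le
    rw [div_le_iff₀ hw] at h3
    have h4 := le_decayRate (θ := θ) (n := n) hL hk2.1.le (by linarith [hk2.2])
    have h5 : 0 < decayRate L θ k n := lt_of_lt_of_le (by linarith) h4
    rw [beta_of_decayRate_pos h5]
    exact mul_ne_zero Complex.I_ne_zero (by exact_mod_cast h5.ne')

/-! ### Normal convergence of the Rayleigh series of kernels. -/

section RayleighKernel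

variable {D : Set Plane} {L θ h γ a b k₀ : ℝ} {j : ℕ}

theorem combined_planeWave (L θ γ k : ℝ) (n : ℤ) (y : Plane) :
    combined D γ (fun s => planeWave L θ k n (-s)) y = -planeWave L θ k n (-y) *
      (Complex.I * alpha L θ k n * normal D y 0 + Complex.I * beta L θ k n * normal D y 1 +
        Complex.I * γ) := by
  -- The exponent is a real-linear functional, so the derivative of the wave is the wave times this
  -- functional.
  obtain ⟨ℓ, hℓ⟩ : ∃ ℓ : Plane →L[ℝ] ℂ, ∀ v,
      ℓ v = -(Complex.I * alpha L θ k n * v 0 + Complex.I * beta L θ k n * v 1) := by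
    refine ⟨-((EuclideanSpace.proj (𝕜 := ℝ) (0 : Fin 2)).smulRight (Complex.I * alpha L θ k n) +
      (EuclideanSpace.proj (𝕜 := ℝ) (1 : Fin 2)).smulRight (Complex.I * beta L θ k n)), fun v => ?_⟩
    simp only [neg_apply, add_apply, ContinuousLinearMap.smulRight_apply, EuclideanSpace.coe_proj,
      Complex.real_smul]
    ring
  have h1 : (fun s => planeWave L θ k n (-s)) = fun s => Complex.exp (ℓ s) := by
    ext s
    rw [planeWave, hℓ, PiLp.neg_apply, PiLp.neg_apply]
    push_cast
    congr 1
    ring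
  have h2 : HasFDerivAt (fun s => Complex.exp (ℓ s)) (Complex.exp (ℓ y) • ℓ) y :=
    ℓ.hasFDerivAt.cexp
  have h3 : planeWave L θ k n (-y) = Complex.exp (ℓ y) := congrFun h1 y
  rw [combined, h1, h2.fderiv, h3, smul_apply, hℓ (normal D y), smul_eq_mul]
  ring

theorem continuous_combined_planeWave (hD : HasC2Boundary D) (L θ γ : ℝ) (n : ℤ) :
    Continuous fun q : ℝ × frontier D =>
      combined D γ (fun s => planeWave L θ q.1 n (-s)) (q.2 : Plane) := by
  simp only [combined_planeWave]
  have h1 : Continuous fun q : ℝ × frontier D => alpha L θ q.1 n :=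
    (continuous_alpha L θ n).comp continuous_fst
  have h2 : Continuous fun q : ℝ × frontier D => beta L θ q.1 n :=
    (continuous_beta L θ n).comp continuous_fst
  have h3 : Continuous fun q : ℝ × frontier D => normal D q.2 :=
    hD.continuous_normal.comp continuous_snd
  have hm : Continuous fun q : ℝ × frontier D => ((q.1, -(q.2 : Plane)) : ℝ × Plane) := by fun_prop
  have h4 := (continuous_planeWave L θ n).comp hm
  simp only [Function.comp_def] at h4
  fun_prop

/-- The kernel of one term of the Rayleigh series. -/
def rayleighModeKernel (D : Set Plane) (L θ h γ : ℝ) (j : ℕ) (n : ℤ) (k : ℝ) (x y : frontier D) :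
    ℂ :=
  sigma L θ h j k n / beta L θ k n * planeWave L θ k n x *
    combined D γ (fun s => planeWave L θ k n (-s)) (y : Plane)

theorem continuousOn_rayleighModeKernel (hD : HasC2Boundary D) {n : ℤ}
    (hβ : ∀ k ∈ Icc a b, beta L θ k n ≠ 0) :
    ContinuousOn (fun q : ℝ × frontier D × frontier D =>
      rayleighModeKernel D L θ h γ j n q.1 q.2.1 q.2.2) (Icc a b ×ˢ univ) := by
  refine ContinuousOn.mul (ContinuousOn.mul (ContinuousOn.div ?_ ?_ fun q hq => hβ _ hq.1) ?_) ?_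
  · exact ((continuous_sigma L θ h j n).comp continuous_fst).continuousOn
  · exact ((continuous_beta L θ n).comp continuous_fst).continuousOn
  · exact ((continuous_planeWave L θ n).comp (by fun_prop :
      Continuous fun q : ℝ × frontier D × frontier D => ((q.1, q.2.1) : ℝ × Plane))).continuousOn
  · exact ((continuous_combined_planeWave hD L θ γ n).comp (by fun_prop :
      Continuous fun q : ℝ × frontier D × frontier D => (q.1, q.2.2))).continuousOn

theorem norm_combined_planeWave_le (hD : HasC2Boundary D) (hL : 0 < L) (hγ : 0 ≤ γ) {k : ℝ} {n : ℤ}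
    (hk : 0 ≤ k) (hs : 0 < decayRate L θ k n) (y : frontier D) :
    ‖combined D γ (fun s => planeWave L θ k n (-s)) (y : Plane)‖ ≤
      Real.exp (decayRate L θ k n * (y : Plane) 1) *
        (2 * (2 * Real.pi / L * |(n : ℝ)| + k) + γ) := by
  have hα := abs_alpha_le (θ := θ) (n := n) hL hk
  have hν : ∀ i, |normal D y i| ≤ 1 := fun i =>
    (abs_coord_le _ i).trans (hD.norm_normal y.2).le
  rw [combined_planeWave, norm_mul, norm_neg, norm_planeWave hs, PiLp.neg_apply, mul_neg, neg_neg]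
  gcongr
  refine (norm_add_le _ _).trans (add_le_add ((norm_add_le _ _).trans ?_) ?_)
  · rw [beta_of_decayRate_pos hs]
    simp only [norm_mul, Complex.norm_I, one_mul, Complex.norm_real, Real.norm_eq_abs,
      abs_of_pos hs]
    have e1 : |alpha L θ k n| * |normal D y 0| ≤ |alpha L θ k n| * 1 := by gcongr; exact hν 0
    have e2 : decayRate L θ k n * |normal D y 1| ≤ decayRate L θ k n * 1 := by gcongr; exact hν 1
    have e3 := decayRate_le (L := L) (θ := θ) (k := k) (n := n)
    linarith
  · simp [abs_of_nonneg hγ]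

/-- The exponentials combine to `exp(-s (h - (y 1 - x 1)))`, which the gap `ε` makes decay in `n`.
The linear growth of the differentiated wave is cancelled by `1 / |β_n| ≤ 2 / W`; with `W ≥ 3 k` the
quotient is at most `8 + 2 γ / (3 k)`. -/
theorem norm_rayleighModeKernel_le (hD : HasC2Boundary D) (hL : 0 < L) (hh : 0 < h) (hγ : 0 ≤ γ)
    {ε : ℝ} (hε0 : 0 ≤ ε)
    (hε : ∀ x ∈ frontier D, ∀ y ∈ frontier D, y 1 - x 1 ≤ h - ε) {k : ℝ} {n : ℤ}
    (hk : 0 < k) (hn : 3 * k ≤ 2 * Real.pi / L * |(n : ℝ)|) (x y : frontier D) :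
    ‖rayleighModeKernel D L θ h γ j n k x y‖ ≤
      j * (8 + 2 * γ / (3 * k)) * Real.exp (-(2 * Real.pi / L / 2 * ε) * |(n : ℝ)|) := by
  set W := 2 * Real.pi / L * |(n : ℝ)| with hW
  have hW0 : 0 < W := by linarith
  have hsW := le_decayRate (θ := θ) hL hk.le hn
  have hs : 0 < decayRate L θ k n := lt_of_lt_of_le (by positivity) hsW
  set s := decayRate L θ k n with hsdef
  have hβ : ‖beta L θ k n‖ = s := by
    rw [beta_of_decayRate_pos hs, norm_mul, Complex.norm_I, one_mul, Complex.norm_real,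
      Real.norm_of_nonneg hs.le]
  rw [rayleighModeKernel, norm_mul, norm_mul, norm_div, hβ, norm_planeWave hs]
  have e1 := norm_sigma_le (L := L) (θ := θ) (k := k) (n := n) hh j hs
  have e2 := norm_combined_planeWave_le (θ := θ) hD hL hγ hk.le hs y
  calc _ ≤ j * Real.exp (-(s * h)) / (W / 2) * Real.exp (-(s * (x : Plane) 1)) *
        (Real.exp (s * (y : Plane) 1) * (2 * (W + k) + γ)) := by gcongr
    _ = j * (2 * (2 * (W + k) + γ) / W) *
        Real.exp (-(s * (h - ((y : Plane) 1 - (x : Plane) 1)))) := by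
      rw [show -(s * (h - ((y : Plane) 1 - (x : Plane) 1))) =
        -(s * h) + -(s * (x : Plane) 1) + s * (y : Plane) 1 by ring, Real.exp_add, Real.exp_add]
      field_simp
    _ ≤ j * (8 + 2 * γ / (3 * k)) * Real.exp (-(2 * Real.pi / L / 2 * ε) * |(n : ℝ)|) := by
      have e3 : 2 * (2 * (W + k) + γ) / W ≤ 8 + 2 * γ / (3 * k) := by
        have i1 : 2 * γ / W ≤ 2 * γ / (3 * k) := by gcongr
        have i2 : 2 * (2 * (W + k)) / W ≤ 8 := by rw [div_le_iff₀ hW0]; linarith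
        rw [mul_add 2 (2 * (W + k)), add_div]
        linarith
      have e4 : -(s * (h - ((y : Plane) 1 - (x : Plane) 1))) ≤
          -(2 * Real.pi / L / 2 * ε) * |(n : ℝ)| := by
        have i1 := hε x x.2 y y.2
        have i2 : W / 2 * ε ≤ s * (h - ((y : Plane) 1 - (x : Plane) 1)) :=
          mul_le_mul hsW (by linarith) hε0 hs.le
        have i3 : 2 * Real.pi / L / 2 * ε * |(n : ℝ)| = W / 2 * ε := by rw [hW]; ring
        linarith
      gcongr

theorem summable_exp_neg_mul_abs {c : ℝ} (hc : 0 < c) :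
    Summable fun n : ℤ => Real.exp (-c * |(n : ℝ)|) := by
  have h1 : Summable fun n : ℕ => Real.exp (-c * n) := by
    simpa [mul_comm] using Real.summable_exp_nat_mul_iff.mpr (neg_lt_zero.mpr hc)
  refine Summable.of_nat_of_neg ?_ ?_ <;> simpa using h1

/-- The finitely many modes without an exponential estimate are bounded by compactness, and changing
finitely many terms does not affect summability. -/
theorem exists_summable_bound {ι Y : Type*} [TopologicalSpace Y] {T : Set Y} (hT : IsCompact T)
    {f : ι → Y → ℂ} (hf : ∀ i, ContinuousOn (f i) T) {u : ι → ℝ} (hu : Summable u)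
    (hb : ∀ᶠ i in cofinite, ∀ q ∈ T, ‖f i q‖ ≤ u i) :
    ∃ v : ι → ℝ, Summable v ∧ ∀ i, ∀ q ∈ T, ‖f i q‖ ≤ v i := by
  classical
  choose B hB using fun i => hT.exists_bound_of_continuousOn (hf i)
  refine ⟨fun i => if ∀ q ∈ T, ‖f i q‖ ≤ u i then u i else B i, hu.congr_cofinite ?_,
    fun i q hq => ?_⟩
  · filter_upwards [hb] with i hi
    rw [if_pos hi]
  · dsimp only
    split_ifs with h
    · exact h q hq
    · exact hB i q hq

/-- The largest height difference is attained, so the strict inequality leaves a uniform margin. -/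
theorem exists_vertical_gap (hc : IsCompact (frontier D))
    (hshift : ∀ r ∈ frontier D, ∀ r' ∈ frontier D, |r 1 - r' 1| < h) :
    ∃ ε > 0, ∀ x ∈ frontier D, ∀ y ∈ frontier D, y 1 - x 1 ≤ h - ε := by
  rcases (frontier D).eq_empty_or_nonempty with h0 | h0
  · exact ⟨1, one_pos, by simp [h0]⟩
  · have hcont : Continuous fun q : Plane × Plane => q.2 1 - q.1 1 := by fun_prop
    obtain ⟨⟨x, y⟩, hxy, hmax⟩ :=
      (hc.prod hc).exists_isMaxOn (h0.prod h0) hcont.continuousOn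
    refine ⟨h - (y 1 - x 1), ?_, fun x' hx' y' hy' => ?_⟩
    · have := (le_abs_self _).trans_lt (hshift y hxy.2 x hxy.1)
      linarith
    · have : y' 1 - x' 1 ≤ y 1 - x 1 := hmax (a := (x', y')) ⟨hx', hy'⟩
      linarith

/-- A summable bound for the kernels of the terms of the Rayleigh series. -/
theorem exists_rayleigh_bound (hD : HasC2Boundary D) (hc : IsCompact (frontier D)) (hL : 0 < L)
    (hh : 0 < h) (hγ : 0 ≤ γ)
    (hshift : ∀ r ∈ frontier D, ∀ r' ∈ frontier D, |r 1 - r' 1| < h) (ha : 0 < a)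
    (hβ : ∀ k ∈ Icc a b, ∀ n ∉ woodModes L θ k₀, beta L θ k n ≠ 0) :
    ∃ v : ↥(woodModes L θ k₀)ᶜ → ℝ, Summable v ∧ ∀ n : ↥(woodModes L θ k₀)ᶜ, ∀ k ∈ Icc a b,
      ∀ x y, ‖rayleighModeKernel D L θ h γ j n k x y‖ ≤ v n := by
  have : CompactSpace (frontier D) := isCompact_iff_compactSpace.mp hc
  obtain ⟨ε, hε0, hε⟩ := exists_vertical_gap hc hshift
  have hw : 0 < 2 * Real.pi / L := by positivity
  have hu : Summable fun n : ℤ =>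
      j * (8 + 2 * γ / (3 * a)) * Real.exp (-(2 * Real.pi / L / 2 * ε) * |(n : ℝ)|) :=
    (summable_exp_neg_mul_abs (by positivity)).mul_left _
  obtain ⟨v, hv, hvb⟩ := exists_summable_bound
    (T := (Icc a b ×ˢ univ : Set (ℝ × frontier D × frontier D)))
    (f := fun (n : ↥(woodModes L θ k₀)ᶜ) q => rayleighModeKernel D L θ h γ j n q.1 q.2.1 q.2.2)
    (isCompact_Icc.prod isCompact_univ)
    (fun n => continuousOn_rayleighModeKernel hD fun k hk => hβ k hk n n.2)
    (hu.subtype _) (by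
      set N := ⌈3 * b / (2 * Real.pi / L)⌉
      have h1 : ∀ᶠ n : ↥(woodModes L θ k₀)ᶜ in cofinite, (n : ℤ) ∉ Finset.Icc (-N) N :=
        Subtype.val_injective.tendsto_cofinite.eventually
          (Finset.Icc (-N) N).finite_toSet.compl_mem_cofinite
      filter_upwards [h1] with n hn q hq
      rw [Finset.mem_Icc, ← abs_le, not_le] at hn
      have h2 : (N : ℝ) < |((n : ℤ) : ℝ)| := by exact_mod_cast hn
      have h3 := (Int.le_ceil _).trans h2.le
      rw [div_le_iff₀ hw] at h3
      have hk : 0 < q.1 := ha.trans_le hq.1.1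
      refine (norm_rayleighModeKernel_le hD hL hh hγ hε0.le hε hk
        (by linarith [hq.1.2]) _ _).trans ?_
      have h4 := hq.1.1
      dsimp only [Function.comp_apply]
      gcongr)
  exact ⟨v, hv, fun n k hk x y => hvb n (k, x, y) ⟨hk, mem_univ _⟩⟩

/-- The kernel of the Rayleigh series. -/
def rayleighKernel (D : Set Plane) (L θ h γ : ℝ) (j : ℕ) (k₀ k : ℝ) (x y : frontier D) : ℂ :=
  ∑' n : ↥(woodModes L θ k₀)ᶜ, rayleighModeKernel D L θ h γ j n k x y

theorem weaklySingular_rayleighKernel (hD : HasC2Boundary D) (hc : IsCompact (frontier D))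
    (hL : 0 < L) (hh : 0 < h) (hγ : 0 ≤ γ)
    (hshift : ∀ r ∈ frontier D, ∀ r' ∈ frontier D, |r 1 - r' 1| < h) (ha : 0 < a)
    (hβ : ∀ k ∈ Icc a b, ∀ n ∉ woodModes L θ k₀, beta L θ k n ≠ 0) :
    WeaklySingular (Icc a b) (rayleighKernel D L θ h γ j k₀) := by
  have : CompactSpace (frontier D) := isCompact_iff_compactSpace.mp hc
  obtain ⟨v, hv, hvb⟩ := exists_rayleigh_bound (j := j) hD hc hL hh hγ hshift ha hβ
  refine .of_continuousOn isCompact_Icc (continuousOn_tsum (fun n =>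
    continuousOn_rayleighModeKernel hD fun k hk => hβ k hk n n.2) hv fun n q hq =>
      hvb n q.1 hq.1 _ _)

end RayleighKernel

/-- Integral and series are interchanged by the summable bound on the mode kernels and the
finiteness of arc length. This rewrites the series of functionals as a single integral operator and
proves its convergence. -/
theorem hasSum_rayleighTerm {D : TopologicalSpace.Compacts Plane} {L θ h γ a b k₀ k : ℝ} {j : ℕ}
    (hD : HasC2Boundary (D : Set Plane)) (hc : IsCompact (frontier (D : Set Plane)))
    (hL : 0 < L) (hh : 0 < h) (hγ : 0 ≤ γ)
    (hshift : ∀ r ∈ frontier (D : Set Plane), ∀ r' ∈ frontier (D : Set Plane), |r 1 - r' 1| < h)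
    (ha : 0 < a) (hβ : ∀ k ∈ Icc a b, ∀ n ∉ woodModes L θ k₀, beta L θ k n ≠ 0)
    (hk : k ∈ Icc a b) (ψ : C(frontier (D : Set Plane), ℂ)) (x : frontier (D : Set Plane)) :
    HasSum (fun n : ↥(woodModes L θ k₀)ᶜ => rayleighTerm L θ h γ j D k ψ x n)
      (∫ y, rayleighKernel D L θ h γ j k₀ k x y * ψ y ∂(arcLength (D : Set Plane))) := by
  have := (hD.upperRegular_arcLength hc).isFiniteMeasure
  obtain ⟨v, hv, hvb⟩ := exists_rayleigh_bound (j := j) hD hc hL hh hγ hshift ha hβ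
  have hcont : ∀ n : ↥(woodModes L θ k₀)ᶜ, Continuous fun y : frontier (D : Set Plane) =>
      rayleighModeKernel (D : Set Plane) L θ h γ j n k x y * ψ y := fun n =>
    (continuous_const.mul ((continuous_combined_planeWave hD L θ γ n).comp
      (by fun_prop : Continuous fun y : frontier (D : Set Plane) => (k, y)))).mul ψ.continuous
  have hint : ∀ n : ↥(woodModes L θ k₀)ᶜ, Integrable (fun y : frontier (D : Set Plane) =>
      rayleighModeKernel (D : Set Plane) L θ h γ j n k x y * ψ y) (arcLength (D : Set Plane)) :=
    fun n => (hcont n).integrable_of_hasCompactSupport (HasCompactSupport.of_compactSpace _)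
  have hsum := hasSum_integral_of_summable_integral_norm hint (by
    refine Summable.of_nonneg_of_le (fun n => integral_nonneg fun y => norm_nonneg _) (fun n => ?_)
      ((hv.mul_right ‖ψ‖).mul_right ((arcLength (D : Set Plane)).real univ))
    refine (le_abs_self _).trans ((Real.norm_eq_abs _).symm.le.trans
      (norm_integral_le_of_norm_le_const (Eventually.of_forall fun y => ?_)))
    rw [norm_norm, norm_mul]
    exact mul_le_mul (hvb n k hk x y) (ψ.norm_coe_le_norm y) (norm_nonneg _)
      ((norm_nonneg _).trans (hvb n k hk x y)))
  simp only [tsum_mul_right] at hsum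
  refine hsum.congr_fun fun n => ?_
  simp only [rayleighTerm, rayleighFunctional, rayleighModeKernel, mul_assoc]
  rw [integral_const_mul, integral_const_mul]
  ring

theorem opAWellDefined_of_frequency_interval {L θ h γ a b k₀ k : ℝ} {j : ℕ}
    {D : TopologicalSpace.Compacts Plane} (hL : 0 < L) (hh : 0 < h) (hγ : 0 ≤ γ) (hj : 1 ≤ j)
    (hD : HasC2Boundary (D : Set Plane))
    (hdisj : Pairwise fun m n : ℤ => Disjoint (obstacle D L m) (obstacle D L n))
    (hshift : ∀ r ∈ frontier (D : Set Plane), ∀ r' ∈ frontier (D : Set Plane), |r 1 - r' 1| < h)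
    (ha : 0 < a) (hβ : ∀ k ∈ Icc a b, ∀ n ∉ woodModes L θ k₀, beta L θ k n ≠ 0)
    (hk : k ∈ Icc a b) : OpAWellDefined L θ h γ j D k₀ k := by
  have hc : IsCompact (frontier (D : Set Plane)) := isCompact_iff_compactSpace.mpr inferInstance
  have hk0 : 0 < k := ha.trans_le hk.1
  have hlat := lattice_point_eq_zero D.isCompact.isClosed hh hdisj hshift
  have hμ := hD.upperRegular_arcLength hc
  have := hμ.isFiniteMeasure
  refine ⟨hβ k hk, fun r hr r' hr' hrr' => ⟨summable_quasiGreenTerm hL hh hj hk0 _,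
    differentiableAt_quasiGreen hL hh hj hk0 fun n l _ h0 => hrr' ?_⟩, fun ψ r => ?_,
    fun ψ n => ?_, fun ψ r => ?_⟩
  · obtain ⟨rfl, rfl⟩ := hlat r hr r' hr' n l h0
    exact sub_eq_zero.mp (by simpa using h0)
  · exact (weaklySingular_layer hD hc hL hh hj ha hlat).integrable hμ hk r ψ
  · refine Continuous.integrable_of_hasCompactSupport ?_ (HasCompactSupport.of_compactSpace _)
    exact ((continuous_combined_planeWave hD L θ γ n).comp (by fun_prop :
      Continuous fun y : frontier (D : Set Plane) => (k, y))).mul ψ.continuous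
  · exact (hasSum_rayleighTerm hD hc hL hh hγ hshift ha hβ hk ψ r).summable

end WoodScattering

end

/-! ### The operator near a Wood frequency. -/

theorem mainTheorem3 (L θ h γ : ℝ) (j : ℕ) (D₀ : TopologicalSpace.Compacts WoodScattering.Plane)
    (hL : 0 < L) (hh : 0 < h) (hγ : 0 ≤ γ) (hj : 1 ≤ j)
    (hD₀ : WoodScattering.HasC2Boundary (D₀ : Set WoodScattering.Plane))
    (hdisj : Pairwise fun m n : ℤ =>
      Disjoint (WoodScattering.obstacle D₀ L m) (WoodScattering.obstacle D₀ L n))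
    (hshift : ∀ r ∈ frontier (D₀ : Set WoodScattering.Plane),
      ∀ r' ∈ frontier (D₀ : Set WoodScattering.Plane), |r 1 - r' 1| < h)
    (k₀ : ℝ) (hk₀ : k₀ ∈ WoodScattering.woodFrequencies L θ) :
    ∃ δ : ℝ, 0 < δ ∧ δ ≤ k₀ ∧
      (∀ k ∈ Set.Ioo (k₀ - δ) (k₀ + δ), WoodScattering.OpAWellDefined L θ h γ j D₀ k₀ k) ∧
      ∃ A : ℝ → (C(frontier (D₀ : Set WoodScattering.Plane), ℂ) →L[ℂ]
          C(frontier (D₀ : Set WoodScattering.Plane), ℂ)),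
        (∀ k ∈ Set.Ioo (k₀ - δ) (k₀ + δ), ∀ ψ r,
          A k ψ r = WoodScattering.opA L θ h γ j D₀ k₀ k ψ r) ∧
        ContinuousOn A (Set.Ioo (k₀ - δ) (k₀ + δ)) := by
  obtain ⟨hk₀pos, -⟩ := hk₀
  obtain ⟨η, hη0, hη⟩ := Metric.eventually_nhds_iff_ball.mp
    (WoodScattering.eventually_beta_ne_zero hL θ hk₀pos)
  -- Halving keeps even the closed interval inside the positive frequencies with non-vanishing
  -- denominators, so that compactness in `k` is available.
  set δ := min η k₀ / 2 with hδ
  have hδ0 : 0 < δ := by positivity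
  have hδη : δ < η := by
    rw [hδ]; linarith [min_le_left η k₀, lt_min hη0 hk₀pos]
  have hδk : δ < k₀ := by
    rw [hδ]; linarith [min_le_right η k₀, lt_min hη0 hk₀pos]
  have ha : 0 < k₀ - δ := by linarith
  have hβ : ∀ k ∈ Icc (k₀ - δ) (k₀ + δ), ∀ n ∉ WoodScattering.woodModes L θ k₀,
      WoodScattering.beta L θ k n ≠ 0 := fun k hk => hη k (by
    rw [Metric.mem_ball, Real.dist_eq, abs_lt]
    constructor <;> linarith [hk.1, hk.2])
  have hc : IsCompact (frontier (D₀ : Set WoodScattering.Plane)) :=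
    isCompact_iff_compactSpace.mpr inferInstance
  have hlat := WoodScattering.lattice_point_eq_zero D₀.isCompact.isClosed hh hdisj hshift
  have hμ := hD₀.upperRegular_arcLength hc
  obtain ⟨T₁, hT₁, hT₁c⟩ := (WoodScattering.weaklySingular_layer (θ := θ) (γ := γ) (b := k₀ + δ)
    hD₀ hc hL hh hj ha hlat).exists_operator hμ
  obtain ⟨T₂, hT₂, hT₂c⟩ := (WoodScattering.weaklySingular_rayleighKernel (j := j)
    hD₀ hc hL hh hγ hshift ha hβ).exists_operator hμ
  refine ⟨δ, hδ0, hδk.le, fun k hk => WoodScattering.opAWellDefined_of_frequency_interval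
    hL hh hγ hj hD₀ hdisj hshift ha hβ (Ioo_subset_Icc_self hk),
    fun k => (1 / 2 : ℂ) • ContinuousLinearMap.id ℂ _ + T₁ k - (Complex.I / (2 * L)) • T₂ k,
    fun k hk ψ r => ?_, ?_⟩
  · have hk' := Ioo_subset_Icc_self hk
    rw [WoodScattering.opA,
      (WoodScattering.hasSum_rayleighTerm hD₀ hc hL hh hγ hshift ha hβ hk' ψ r).tsum_eq,
      ← hT₂ k hk' ψ r]
    simp only [WoodScattering.layerIntegrand]
    rw [← hT₁ k hk' ψ r]
    simp
  · exact ((continuousOn_const.add hT₁c).sub (hT₂c.const_smul (Complex.I / (2 * L) : ℂ))).mono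
      Ioo_subset_Icc_self
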